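/- Let $k$ be an algebraically closed field, $d \geqslant 1$ an integer, and $\mathscr{T}$ a $k$-linear, $\operatorname{Hom}$-finite $(d+2)$-angulated category (in the sense of Geiss, Keller and Oppermann) with split idempotents and $k$-linear $d$-suspension functor $\Sigma^d$. Write $\operatorname{D} = \operatorname{Hom}_k(-,k)$, and assume that $\mathscr{T}$ is $2d$-Calabi–Yau, that is, $\mathscr{T}(X,Y) \cong \operatorname{D}\mathscr{T}(Y,\Sigma^{2d}X)$ naturally in $X,Y \in \mathscr{T}$, where $\Sigma^{2d} = (\Sigma^d)^2$. Put $\operatorname{Ext}^d_{\mathscr{T}}(X,Y) = \mathscr{T}(X,\Sigma^d Y)$. For an object $X$ of an additive category, let $\operatorname{add} X$ be the class of direct summands of finite direct sums of copies of $X$. Let $T \in \mathscr{T}$ be an Oppermann–Thomas cluster tilting object, that is, $\operatorname{Ext}^d_{\mathscr{T}}(T,T) = 0$ and for each $Y \in \mathscr{T}$ there is a $(d+2)$-angle $T_d \to \cdots \to T_0 \to Y \to \Sigma^d T_d$ with $T_i \in \operatorname{add} T$ for $0 \leqslant i \leqslant d$. Let $\Gamma = \operatorname{End}_{\mathscr{T}}(T)$,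 let $\operatorname{mod}\Gamma$ be the category of finitely generated right $\Gamma$-modules, let $\operatorname{proj}\Gamma$ be its full subcategory of projective modules, and let $\mathscr{D}$ be the essential image of the functor $\mathscr{T}(T,-) : \mathscr{T} \to \operatorname{mod}\Gamma$. For $M \in \operatorname{mod}\Gamma$ let $\tau_d M$ be the $d$-Auslander–Reiten translation of $M$, that is, the kernel of $\nu P_d \to \nu P_{d-1}$, where $P_d \to \cdots \to P_0 \to M \to 0$ is the start of an augmented minimal projective resolution of $M$ and $\nu = \operatorname{D}\operatorname{Hom}_\Gamma(-,\Gamma)$ is the Nakayama functor. An object $X \in \mathscr{T}$ is $d$-rigid if $\operatorname{Ext}^d_{\mathscr{T}}(X,X) = 0$, and $d$-self-perpendicular if $\operatorname{add} X = \{\, Y \in \mathscr{T} \mid \operatorname{Ext}^d_{\mathscr{T}}(X,Y) = 0 \,\}$. Let $(M,P)$ be a pair with $M \in \mathscr{D}$ and $P \in \operatorname{proj}\Gamma$. It is a $\tau_d$-rigid pair in $\mathscr{D}$ if $\operatorname{Hom}_\Gamma(M,\tau_d M) = 0$ and $\operatorname{Hom}_\Gamma(P,M) = 0$. It is a maximal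 $\tau_d$-rigid pair in $\mathscr{D}$ if * for each $N \in \mathscr{D}$, one has $N \in \operatorname{add} M$ if and only if $\operatorname{Hom}_\Gamma(M,\tau_d N) = 0$, $\operatorname{Hom}_\Gamma(N,\tau_d M) = 0$ and $\operatorname{Hom}_\Gamma(P,N) = 0$; and * for each $Q \in \operatorname{proj}\Gamma$, one has $Q \in \operatorname{add} P$ if and only if $\operatorname{Hom}_\Gamma(Q,M) = 0$. Write $\operatorname{iso}$ for the set of isomorphism classes of objects of a skeletally small category. Then $\mathscr{T}$ is skeletally small, and each $X \in \mathscr{T}$ has a decomposition $X \cong X' \oplus X''$ such that $X'$ has no non-zero direct summands in $\operatorname{add}\Sigma^d T$ and $X'' \in \operatorname{add}\Sigma^d T$. Setting $\Delta(X) = \big( \mathscr{T}(T,X'), \mathscr{T}(T,\Sigma^{-d}X'') \big)$ for such a decomposition induces a well-defined bijection $$\delta : \operatorname{iso}\mathscr{T} \to \operatorname{iso}\mathscr{D} \times \operatorname{iso}\operatorname{proj}\Gamma,$$ which does not depend on the chosen decompositions, and the following hold. 1. $\delta$ restricts to a bijection from the isomorphism classes of $d$-rigid objects in $\mathscr{T}$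 to the isomorphism classes of $\tau_d$-rigid pairs in $\mathscr{D}$. 2. $\delta$ restricts further to a bijection from the isomorphism classes of $d$-self-perpendicular objects in $\mathscr{T}$ to the isomorphism classes of maximal $\tau_d$-rigid pairs in $\mathscr{D}$. -/

import Mathlib

open CategoryTheory CategoryTheory.Limits

universe w v u

namespace HigherAngulated

noncomputable section

/-! ### `(d+2)`-angulated categories -/

section Angulated

variable {C : Type u} [Category.{v} C] [Preadditive C]

/-- A `Sus`-sequence with `d+2` terms, written in the form
`X_d ⟶ ⋯ ⟶ X_0 ⟶ Y ⟶ Sus X_d`. The terms are numbered from right to left: `obj 0` is the last term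
`Y`, `obj (i+1)` is `X_i`, so that `obj (Fin.last _)` is the first term `X_d`.
The suspension `Sus` may be any autoequivalence (in particular an automorphism). -/
structure SusSeq (Sus : C ≌ C) (d : ℕ) where
  /-- the terms, from right to left -/
  obj : Fin (d + 2) → C
  /-- the morphisms between consecutive terms -/
  map : ∀ i : Fin (d + 1), obj i.succ ⟶ obj i.castSucc
  /-- the closing morphism, from the last term to the suspension of the first term -/
  close : obj 0 ⟶ Sus.functor.obj (obj (Fin.last (d + 1)))

namespace SusSeq

variable {Sus : C ≌ C} {d : ℕ}

/-- The first term of the sequence. -/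
abbrev fst (S : SusSeq Sus d) : C := S.obj (Fin.last d).succ

/-- The second term of the sequence. -/
abbrev snd (S : SusSeq Sus d) : C := S.obj (Fin.last d).castSucc

/-- The first morphism of the sequence. -/
abbrev firstMap (S : SusSeq Sus d) : S.fst ⟶ S.snd := S.map (Fin.last d)

/-- Morphisms of `Sus`-sequences. -/
structure Hom (S S' : SusSeq Sus d) where
  /-- the components -/
  app : ∀ i, S.obj i ⟶ S'.obj i
  comm : ∀ i : Fin (d + 1), S.map i ≫ app i.castSucc = app i.succ ≫ S'.map i
  comm_close : S.close ≫ Sus.functor.map (app (Fin.last (d + 1))) = app 0 ≫ S'.close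

/-- `R` is a direct summand of `S`: there are morphisms `R ⟶ S ⟶ R` with composite the identity.
(When idempotents split in `C`, such an `R` has a complement in `S`.) -/
def IsSummand (R S : SusSeq Sus d) : Prop :=
  ∃ (i : Hom R S) (r : Hom S R), ∀ j, i.app j ≫ r.app j = 𝟙 (R.obj j)

/-- The left rotation of `X_1 ⟶ X_2 ⟶ ⋯ ⟶ X_n ⟶ Sus X_1` (where `n = d+2`), namely
`X_2 ⟶ ⋯ ⟶ X_n ⟶ Sus X_1 ⟶ Sus X_2` with last morphism `(-1)^n Sus α_1`. -/
def rotate (S : SusSeq Sus d) : SusSeq Sus d where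
  obj := Fin.cons (Sus.functor.obj S.fst) (fun i : Fin (d + 1) => S.obj i.castSucc)
  map := Fin.cases S.close (fun j : Fin d => S.map j.castSucc)
  close := ((-1 : ℤ) ^ (d + 2)) • Sus.functor.map S.firstMap

variable [HasBinaryBiproducts C]

/-- The direct sum of two `Sus`-sequences. -/
def directSum (S S' : SusSeq Sus d) : SusSeq Sus d where
  obj i := S.obj i ⊞ S'.obj i
  map i := biprod.map (S.map i) (S'.map i)
  close :=
    biprod.fst ≫ S.close ≫ Sus.functor.map biprod.inl +
      biprod.snd ≫ S'.close ≫ Sus.functor.map biprod.inr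

/-- The first morphism of `S`, as a morphism to the first term of the rotation of `S`. -/
abbrev firstMapRotate (S : SusSeq Sus d) :
    S.obj (Fin.last (d + 1)) ⟶ S.rotate.obj (Fin.last (d + 1)) := S.firstMap

/-- The components of a morphism, as morphisms from the terms of the rotation. -/
abbrev Hom.appRotate {S S' : SusSeq Sus d} (φ : Hom S S') (i : Fin (d + 1)) :
    S.rotate.obj i.succ ⟶ S'.obj i.castSucc := φ.app i.castSucc

/-- The mapping cone of `φ : X ⟶ Y`, namely
`X_2 ⊞ Y_1 ⟶ X_3 ⊞ Y_2 ⟶ ⋯ ⟶ Sus X_1 ⊞ Y_n ⟶ Sus X_2 ⊞ Sus Y_1`, where a summand `X_{i+1}` is mapped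
by `-α_{i+1}` and `φ_{i+1}`, and a summand `Y_i` is mapped by `β_i`
(with `α_{n+1} = Sus α_1` and `φ_{n+1} = Sus φ_1`).
The terms are those of the left rotation of `X` plus those of `Y`. -/
def cone {S S' : SusSeq Sus d} (φ : Hom S S') : SusSeq Sus d where
  obj i := S.rotate.obj i ⊞ S'.obj i
  map i :=
    biprod.fst ≫ (-(S.rotate.map i) ≫ biprod.inl + φ.appRotate i ≫ biprod.inr) +
      biprod.snd ≫ S'.map i ≫ biprod.inr
  close :=
    biprod.fst ≫ Sus.functor.map
        (-S.firstMapRotate ≫ biprod.inl + φ.app (Fin.last (d + 1)) ≫ biprod.inr) +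
      biprod.snd ≫ S'.close ≫ Sus.functor.map biprod.inr

end SusSeq

/-- The structure of a `(d+2)`-angulated category on an additive category `C` with suspension `Sus`,
in the sense of Geiss, Keller and Oppermann. -/
structure Angulation [HasBinaryBiproducts C] (Sus : C ≌ C) (d : ℕ) where
  /-- the class of `(d+2)`-angles -/
  angle : SusSeq Sus d → Prop
  angle_directSum : ∀ S S', angle S → angle S' → angle (S.directSum S')
  angle_summand : ∀ R S, R.IsSummand S → angle S → angle R
  /-- sequences (isomorphic to one) of the form `X = X ⟶ 0 ⟶ ⋯ ⟶ 0 ⟶ Sus X` are angles -/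
  angle_trivial : ∀ S : SusSeq Sus d, IsIso S.firstMap →
    (∀ i : Fin (d + 2), i.val < d → IsZero (S.obj i)) → angle S
  /-- each morphism is the first morphism of an angle -/
  exists_angle : ∀ {A B : C} (f : A ⟶ B), ∃ S : SusSeq Sus d, angle S ∧
    ∃ (a : A ≅ S.fst) (b : B ≅ S.snd), f ≫ b.hom = a.hom ≫ S.firstMap
  angle_rotate_iff : ∀ S, angle S.rotate ↔ angle S
  /-- each commutative square between first morphisms of angles extends to a morphism of
  `Sus`-sequences whose mapping cone is an angle -/
  exists_hom : ∀ S S' : SusSeq Sus d, angle S → angle S' →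
    ∀ (φ₁ : S.fst ⟶ S'.fst) (φ₂ : S.snd ⟶ S'.snd), S.firstMap ≫ φ₂ = φ₁ ≫ S'.firstMap →
      ∃ φ : SusSeq.Hom S S', φ.app (Fin.last d).succ = φ₁ ∧ φ.app (Fin.last d).castSucc = φ₂ ∧
        angle (SusSeq.cone φ)

/-- `C` is `2d`-Calabi-Yau: `Hom(X, Y) ≅ D Hom(Y, Σ^{2d} X)` naturally in `X` and `Y`, where
`Sus = Σ^d` is the `d`-suspension, so that `Σ^{2d}` is the square of `Sus`. -/
def IsCalabiYau (k : Type w) [Field k] [Linear k C] (Sus : C ≌ C) : Prop :=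
  ∃ e : ∀ X Y : C, (X ⟶ Y) ≃ₗ[k] Module.Dual k (Y ⟶ Sus.functor.obj (Sus.functor.obj X)),
    ∀ {X X' Y Y' : C} (f : X' ⟶ X) (g : Y ⟶ Y') (x : X ⟶ Y)
      (y : Y' ⟶ Sus.functor.obj (Sus.functor.obj X')),
      e X' Y' (f ≫ x ≫ g) y = e X Y x (g ≫ y ≫ Sus.functor.map (Sus.functor.map f))

/-- `add X`: the direct summands of finite direct sums of copies of `X`. -/
def addClosure {A : Type*} [Category A] [HasZeroMorphisms A] [HasFiniteBiproducts A] (X : A) :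
    ObjectProperty A :=
  fun Y => ∃ n : ℕ, Nonempty (Retract Y (⨁ fun _ : Fin n => X))

/-- `Ext^d(X, Y) = Hom(X, Σ^d Y)` is zero. -/
def ExtVanishes (Sus : C ≌ C) (X Y : C) : Prop :=
  ∀ f : X ⟶ Sus.functor.obj Y, f = 0

/-- `d`-rigid objects. -/
def IsRigid (Sus : C ≌ C) (X : C) : Prop := ExtVanishes Sus X X

variable [HasFiniteBiproducts C]

/-- `d`-self-perpendicular objects: `add X = {Y | Ext^d(X, Y) = 0}`. -/
def IsSelfPerpendicular (Sus : C ≌ C) (X : C) : Prop :=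
  ∀ Y : C, addClosure X Y ↔ ExtVanishes Sus X Y

/-- Oppermann-Thomas cluster tilting objects: `T` is `d`-rigid, and each `Y` sits in a `(d+2)`-angle
`T_d ⟶ ⋯ ⟶ T_0 ⟶ Y ⟶ Σ^d T_d` with all `T_i` in `add T`. -/
def IsClusterTilting [HasBinaryBiproducts C] {Sus : C ≌ C} {d : ℕ} (A : Angulation Sus d) (T : C) :
    Prop :=
  IsRigid Sus T ∧ ∀ Y : C, ∃ S : SusSeq Sus d, A.angle S ∧ Nonempty (S.obj 0 ≅ Y) ∧
    ∀ i : Fin (d + 1), addClosure T (S.obj i.succ)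

end Angulated

/-! ### The `d`-Auslander-Reiten translation -/

section Modules

/-- The Nakayama functor on objects: `ν P = D Hom_R(P, R)`, with `D = Hom_k(-, k)`. -/
def Nakayama (k : Type w) [Field k] (R : Type v) [Ring R] [Algebra k R] (P : Type v)
    [AddCommGroup P] [Module R P] : Type (max v w) :=
  Module.Dual k (P →ₗ[R] R)

section Nakayama

variable (k : Type w) [Field k] {R : Type v} [Ring R] [Algebra k R]

instance (P : Type v) [AddCommGroup P] [Module R P] : AddCommGroup (Nakayama k R P) :=
  inferInstanceAs (AddCommGroup (Module.Dual k (P →ₗ[R] R)))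

/-- An element of `ν P = D Hom_R(P, R)` as a linear form on `Hom_R(P, R)`. -/
abbrev Nakayama.toDual {k : Type w} [Field k] {R : Type v} [Ring R] [Algebra k R] {P : Type v}
    [AddCommGroup P] [Module R P] (φ : Nakayama k R P) : Module.Dual k (P →ₗ[R] R) := φ

/-- Right multiplication by `r` on the values of a linear map `P → R`. This is the right `R`-module
structure of `Hom_R(P, R)`. -/
def rightMul (P : Type v) [AddCommGroup P] [Module R P] (r : R) :
    (P →ₗ[R] R) →ₗ[k] (P →ₗ[R] R) where
  toFun f :=
    { toFun := fun p => f p * r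
      map_add' := fun p q => by rw [map_add, add_mul]
      map_smul' := fun s p => by
        rw [map_smul, smul_eq_mul, smul_eq_mul, mul_assoc, RingHom.id_apply] }
  map_add' f g := LinearMap.ext fun p => add_mul (f p) (g p) r
  map_smul' c f := LinearMap.ext fun p => smul_mul_assoc c (f p) r

/-- The left `R`-module structure of `D Hom_R(P, R)`, given by `(r • φ) f = φ (f · r)`. -/
instance (P : Type v) [AddCommGroup P] [Module R P] : Module R (Nakayama k R P) where
  smul r φ := LinearMap.comp φ.toDual (rightMul k P r)
  one_smul φ := LinearMap.ext fun f => congrArg φ.toDual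
    (LinearMap.ext fun p => mul_one (f p))
  mul_smul r s φ := LinearMap.ext fun f => congrArg φ.toDual
    (LinearMap.ext fun p => (mul_assoc (f p) r s).symm)
  smul_zero _ := rfl
  smul_add _ _ _ := rfl
  add_smul r s φ := LinearMap.ext fun f =>
    (congrArg φ.toDual
      (LinearMap.ext fun p => mul_add (f p) r s : rightMul k P (r + s) f =
        rightMul k P r f + rightMul k P s f)).trans (map_add _ _ _)
  zero_smul φ := LinearMap.ext fun f =>
    (congrArg φ.toDual
      (LinearMap.ext fun p => mul_zero (f p) : rightMul k P 0 f = 0)).trans (map_zero _)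

/-- The Nakayama functor on morphisms: `(ν f) φ = φ ∘ Hom_R(f, R)`. -/
def nakayamaMap {P Q : Type v} [AddCommGroup P] [Module R P] [AddCommGroup Q] [Module R Q]
    (f : P →ₗ[R] Q) : Nakayama k R P →ₗ[R] Nakayama k R Q where
  toFun φ := LinearMap.comp φ.toDual
    ({ toFun := fun g => g.comp f
       map_add' := fun _ _ => rfl
       map_smul' := fun _ _ => rfl } : (Q →ₗ[R] R) →ₗ[k] (P →ₗ[R] R))
  map_add' _ _ := rfl
  map_smul' _ _ := rfl

end Nakayama

variable {R : Type v} [Ring R]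

/-- Superfluous submodules. A surjection with superfluous kernel from a projective module is a
projective cover. -/
def IsSuperfluous {M : Type v} [AddCommGroup M] [Module R M] (N : Submodule R M) : Prop :=
  ∀ L : Submodule R M, N ⊔ L = ⊤ → L = ⊤

/-- The start `P_d ⟶ ⋯ ⟶ P_0 ⟶ M ⟶ 0` of an augmented minimal projective resolution of `M` by
finitely generated projective modules: `P_0 ⟶ M`, `P_1 ⟶ Ker(P_0 ⟶ M)` and
`P_{i+1} ⟶ Ker(P_i ⟶ P_{i-1})` for `0 < i < d` are projective covers.
(The terms `P_i` with `i > d` carry no condition and play no role.) -/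
structure MinimalResolution (d : ℕ) (M : Type v) [AddCommGroup M] [Module R M] where
  /-- the terms -/
  P : ℕ → ModuleCat.{v} R
  /-- the differentials -/
  δ (i : ℕ) : P (i + 1) →ₗ[R] P i
  /-- the augmentation -/
  ε : P 0 →ₗ[R] M
  finite : ∀ i ≤ d, Module.Finite R (P i)
  projective : ∀ i ≤ d, Module.Projective R (P i)
  surjective_ε : Function.Surjective ε
  exact_zero : 0 < d → Function.Exact (δ 0) ε
  exact_succ : ∀ i, i + 1 < d → Function.Exact (δ (i + 1)) (δ i)
  superfluous_ε : IsSuperfluous (LinearMap.ker ε)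
  superfluous_δ : ∀ i < d, IsSuperfluous (LinearMap.ker (δ i))

open Classical in
/-- The `d`-Auslander-Reiten translation (for `d ≥ 1`) of a finitely generated module `M` over a
finite dimensional `k`-algebra `R`: the kernel of `ν P_d ⟶ ν P_{d-1}`, where `P_d ⟶ ⋯ ⟶ P_0 ⟶ M` is
the start of a minimal projective resolution. It does not depend on the choice of the resolution up
to isomorphism. (The value is zero if `M` has no such resolution.) -/
def tauD (k : Type w) [Field k] [Algebra k R] (d : ℕ) (M : ModuleCat.{v} R) :
    ModuleCat.{max v w} R :=
  if h : Nonempty (MinimalResolution (R := R) d M) then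
    ModuleCat.of R (LinearMap.ker (nakayamaMap k (h.some.δ (d - 1))))
  else ModuleCat.of R PUnit

/-- `proj R`: the finitely generated projective modules. -/
def proj (R : Type v) [Ring R] : ObjectProperty (ModuleCat.{v} R) :=
  fun P => Module.Finite R P ∧ Module.Projective R P

/-- `Hom_R(M, τ_d N)` is zero. -/
def HomTauVanishes (k : Type w) [Field k] [Algebra k R] (d : ℕ) (M N : ModuleCat.{v} R) : Prop :=
  ∀ f : M →ₗ[R] tauD k d N, f = 0

/-- `Hom_R(M, N)` is zero. -/
def HomVanishes (M N : ModuleCat.{v} R) : Prop := ∀ f : M →ₗ[R] N, f = 0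

variable {𝒟 : ObjectProperty (ModuleCat.{v} R)}

/-- `τ_d`-rigid pairs `(M, P)` with `M` in `𝒟` and `P` in `proj R`. -/
def IsTauRigidPair (k : Type w) [Field k] [Algebra k R] (d : ℕ)
    (p : 𝒟.FullSubcategory × (proj R).FullSubcategory) : Prop :=
  HomTauVanishes k d p.1.obj p.1.obj ∧ HomVanishes p.2.obj p.1.obj

/-- Maximal `τ_d`-rigid pairs `(M, P)` with `M` in `𝒟` and `P` in `proj R`. -/
def IsMaximalTauRigidPair (k : Type w) [Field k] [Algebra k R] (d : ℕ)
    (p : 𝒟.FullSubcategory × (proj R).FullSubcategory) : Prop :=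
  (∀ N : 𝒟.FullSubcategory, addClosure p.1.obj N.obj ↔
    HomTauVanishes k d p.1.obj N.obj ∧ HomTauVanishes k d N.obj p.1.obj ∧
      HomVanishes p.2.obj N.obj) ∧
  (∀ Q : (proj R).FullSubcategory, addClosure p.2.obj Q.obj ↔ HomVanishes Q.obj p.1.obj)

end Modules

/-! ### The map `Δ` -/

/-- The set (type) of isomorphism classes of a category. -/
abbrev IsoClasses (A : Type*) [Category A] := Quotient (isIsomorphicSetoid A)

/-- The isomorphism class of an object. -/
abbrev isoClass {A : Type*} [Category A] (X : A) : IsoClasses A :=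
  Quotient.mk (isIsomorphicSetoid A) X

/-- The isomorphism class of a pair of objects. -/
abbrev isoClassPair {A B : Type*} [Category A] [Category B] (p : A × B) :
    IsoClasses A × IsoClasses B :=
  (isoClass p.1, isoClass p.2)

section Delta

variable {C : Type u} [Category.{v} C] [Preadditive C]

/-- The endomorphism ring `Γ` of `T`, with the multiplication for which left modules in Mathlib's
sense are the modules over the usual endomorphism ring that act on `Hom(T, X)` by precomposition. -/
abbrev Gam (T : C) : Type v := (End T)ᵐᵒᵖ

/-- The functor `Hom(T, -)` from `C` to `Γ`-modules. -/
abbrev homFrom (T : C) : C ⥤ ModuleCat.{v} (Gam T) := preadditiveCoyonedaObj T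

/-- `𝒟`: the essential image of `Hom(T, -)`. -/
abbrev imageD (T : C) : ObjectProperty (ModuleCat.{v} (Gam T)) := (homFrom T).essImage

variable [HasFiniteBiproducts C]

/-- `Hom(T, -)` sends `add T` to `proj Γ`. -/
lemma proj_homFrom {T Y : C} (h : addClosure T Y) : proj (Gam T) ((homFrom T).obj Y) := by
  obtain ⟨n, ⟨ρ⟩⟩ := h
  let i : (T ⟶ Y) →ₗ[Gam T] (Fin n → Gam T) :=
    { toFun := fun f j => MulOpposite.op (f ≫ ρ.i ≫ biproduct.π _ j)
      map_add' := fun f g => by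
        funext j
        exact congrArg MulOpposite.op (Preadditive.add_comp _ _ _ _ _ _)
      map_smul' := fun r f => by
        funext j
        exact congrArg MulOpposite.op (Category.assoc r.unop f _) }
  let r : (Fin n → Gam T) →ₗ[Gam T] (T ⟶ Y) :=
    { toFun := fun g => ∑ j, ((g j).unop : T ⟶ T) ≫ biproduct.ι (fun _ : Fin n => T) j ≫ ρ.r
      map_add' := fun g g' => by
        rw [← Finset.sum_add_distrib]
        exact Finset.sum_congr rfl fun j _ => Preadditive.add_comp _ _ _ _ _ _
      map_smul' := fun s g => by
        refine Eq.trans ?_ (Preadditive.comp_sum Finset.univ (s.unop : T ⟶ T)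
          (fun j => ((g j).unop : T ⟶ T) ≫ biproduct.ι (fun _ : Fin n => T) j ≫ ρ.r)).symm
        exact Finset.sum_congr rfl fun j _ => Category.assoc _ _ _ }
  have hri : r.comp i = LinearMap.id := by
    refine LinearMap.ext fun f => ?_
    change ∑ j, (f ≫ ρ.i ≫ biproduct.π _ j) ≫ biproduct.ι (fun _ : Fin n => T) j ≫ ρ.r = f
    have : ∀ j, (f ≫ ρ.i ≫ biproduct.π (fun _ : Fin n => T) j) ≫
        biproduct.ι (fun _ : Fin n => T) j ≫ ρ.r =
        (f ≫ ρ.i) ≫ (biproduct.π (fun _ : Fin n => T) j ≫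
          biproduct.ι (fun _ : Fin n => T) j) ≫ ρ.r := fun j => by simp only [Category.assoc]
    rw [Finset.sum_congr rfl fun j _ => this j, ← Preadditive.comp_sum, ← Preadditive.sum_comp,
      biproduct.total, Category.id_comp, Category.assoc, ρ.retract, Category.comp_id]
  constructor
  · exact Module.Finite.of_surjective r (fun f => ⟨i f, LinearMap.congr_fun hri f⟩)
  · exact Module.Projective.of_split i r hri

/-- `Σ^{-d}` sends `add Σ^d T` to `add T`. -/
lemma addClosure_inverse {Sus : C ≌ C} [Sus.functor.Additive] {T Y : C}
    (h : addClosure (Sus.functor.obj T) Y) : addClosure T (Sus.inverse.obj Y) := by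
  obtain ⟨n, ⟨ρ⟩⟩ := h
  exact ⟨n, ⟨(ρ.map Sus.inverse).trans (Retract.ofIso
    (Sus.inverse.mapBiproduct _ ≪≫ biproduct.mapIso fun _ => (Sus.unitIso.app T).symm))⟩⟩

/-- A decomposition `X ≅ X' ⊕ X''` such that `X'` has no non-zero direct summands in `add Σ^d T` and
`X''` is in `add Σ^d T`. -/
structure Decomposition [HasBinaryBiproducts C] (Sus : C ≌ C) (T X : C) where
  /-- the part without summands in `add Σ^d T` -/
  X' : C
  /-- the part in `add Σ^d T` -/
  X'' : C
  /-- the decomposition -/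
  iso : X ≅ X' ⊞ X''
  isZero_of_summand : ∀ Z : C, addClosure (Sus.functor.obj T) Z → Nonempty (Retract Z X') → IsZero Z
  mem_add : addClosure (Sus.functor.obj T) X''

/-- The pair `Δ(X) = (Hom(T, X'), Hom(T, Σ^{-d} X''))` given by a decomposition `X ≅ X' ⊕ X''`. -/
def Decomposition.Δ [HasBinaryBiproducts C] {Sus : C ≌ C} [Sus.functor.Additive] {T X : C}
    (c : Decomposition Sus T X) :
    (imageD T).FullSubcategory × (proj (Gam T)).FullSubcategory :=
  (⟨(homFrom T).obj c.X', (homFrom T).obj_mem_essImage c.X'⟩,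
    ⟨(homFrom T).obj (Sus.inverse.obj c.X''), proj_homFrom (addClosure_inverse c.mem_add)⟩)

end Delta

end

end HigherAngulated

open HigherAngulated

namespace HigherAngulated

noncomputable section

/-! ### Idempotents in finite dimensional algebras -/

section Fitting

/-! Since `T` is rigid, `Hom(T, -)` kills `add Σ^d T`. The angles with terms in `add T` show more:
the functor is full (`homFrom_full`), and a morphism is killed exactly when it factors through `add
Σ^d T` (`exists_factorization_of_homFrom_map_eq_zero`). Endomorphisms of this kind are radical on an
object without summands in `add Σ^d T` (`IsReduced.radPair`), so such an object is recovered from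
its module. The remaining summand `Σ^d Q` is recovered from the projective module `Hom(T, Q)`. With
cancellation of summands this gives the bijection, stated through the relation `Corresponds`, which
refers to no chosen decomposition.

For rigidity, let `Y` have no summands in `add Σ^d T`, and put `M = Hom(T, X)`, `N = Hom(T, Y)`. The
functor turns the angle `T_d ⟶ ⋯ ⟶ T_0 ⟶ Y` into the start of a projective resolution of `N`. It
need not be minimal, but the absence of summands makes it close enough for
`IsAcyclic.hom_surjective_iff`. As `Hom(M, νP)` is dual to `Hom(P, M)`, the condition `Hom(M, τ_d N)
= 0` says that morphisms `T_d ⟶ X` extend along `T_d ⟶ T_{d-1}`. By exactness of the angle, this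
says that all composites `Y ⟶ Σ^d T ⟶ Σ^d X` vanish (`homTauVanishes_iff_comp_eq_zero`).

By the Calabi-Yau property, `Ext(X, Y) = 0` if and only if these composites and those with `X` and
`Y` exchanged vanish (`IsCalabiYau.extVanishes_iff`). The other conditions come from `Ext(Σ^d Q, X)
≅ Hom(Q, X)` and `Ext(Σ^d Q, Σ^d Q') = 0`. Splitting objects into their two parts then gives both
statements. -/

lemma exists_pow_eq_pow_succ_mul (k : Type*) [Field k] {A : Type*} [Ring A] [Algebra k A]
    [Module.Finite k A] (a : A) : ∃ (n : ℕ) (c : A), Commute a c ∧ a ^ n = a ^ (n + 1) * c := by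
  have hp : minpoly k a ≠ 0 := minpoly.ne_zero (Algebra.IsIntegral.isIntegral a)
  obtain ⟨q, hq, hdvd⟩ :=
    Polynomial.exists_eq_pow_rootMultiplicity_mul_and_not_dvd (minpoly k a) hp 0
  rw [map_zero, sub_zero] at hq hdvd
  set n := (minpoly k a).rootMultiplicity 0
  have h0 : q.coeff 0 ≠ 0 := fun h => hdvd (Polynomial.X_dvd_iff.2 h)
  have ha : a ^ n * Polynomial.aeval a q = 0 := by
    have := minpoly.aeval k a
    rwa [hq, map_mul, map_pow, Polynomial.aeval_X] at this
  have hq' : Polynomial.aeval a q = a * Polynomial.aeval a q.divX + algebraMap k A (q.coeff 0) := by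
    conv_lhs => rw [← Polynomial.X_mul_divX_add q]
    rw [map_add, map_mul, Polynomial.aeval_X, Polynomial.aeval_C]
  have hc : Commute a (Polynomial.aeval a q.divX) := by
    have := Commute.all (Polynomial.X : Polynomial k) q.divX
    simpa using this.map (Polynomial.aeval a)
  -- The minimal polynomial is `X ^ n * q` with `q(0) ≠ 0`; the witness comes from solving `a ^ n *
  -- q(a) = 0` for the term with the constant coefficient.
  refine ⟨n, -((q.coeff 0)⁻¹ • Polynomial.aeval a q.divX), (hc.smul_right _).neg_right, ?_⟩
  rw [hq', mul_add, ← Algebra.commutes, ← Algebra.smul_def] at ha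
  have h2 : a ^ n = (q.coeff 0)⁻¹ • (q.coeff 0 • a ^ n) := by
    rw [smul_smul, inv_mul_cancel₀ h0, one_smul]
  rw [h2, eq_neg_of_add_eq_zero_right ha, pow_succ, mul_neg, mul_smul_comm, smul_neg, mul_assoc]

/-- Fitting's lemma, in the form of an idempotent that is a multiple of `a`. -/
lemma exists_idempotent_multiple (k : Type*) [Field k] {A : Type*} [Ring A] [Algebra k A]
    [Module.Finite k A] (a : A) :
    ∃ e b : A, e * e = e ∧ e = b * a ∧ (e = 0 → IsNilpotent a) := by
  obtain ⟨n, c, hc, h⟩ := exists_pow_eq_pow_succ_mul k a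
  have key : ∀ m, a ^ n = a ^ (n + m) * c ^ m := by
    intro m
    induction m with
    | zero => simp
    | succ m ih =>
      rw [ih]
      conv_lhs => rw [add_comm n m, pow_add, h]
      rw [pow_succ' c m, ← mul_assoc, ← mul_assoc, ← pow_add]
      congr 3; omega
  have key1 : a ^ (n + 1) = a ^ (n + 1) * (a ^ (n + 1) * c ^ (n + 1)) := by
    rw [← mul_assoc, ← pow_add, pow_succ, ]
    conv_lhs => rw [key (n + 1)]
    rw [mul_assoc, (hc.symm.pow_left (n + 1)).eq, ← mul_assoc, ← pow_succ]
    congr 2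
    omega
  have hcc : Commute (c ^ (n + 1)) (a ^ (n + 1)) := (hc.symm.pow_pow _ _)
  -- The exponent is `n + 1` rather than `n` so that a factor `a` can be split off even if `n = 0`.
  refine ⟨a ^ (n + 1) * c ^ (n + 1), c ^ (n + 1) * a ^ n, ?_, ?_, fun h0 => ⟨n + 1, ?_⟩⟩
  · conv_rhs => rw [key1, mul_assoc]
    rw [mul_assoc, mul_assoc]
    congr 1
    rw [← mul_assoc, hcc.eq, mul_assoc]
  · rw [← hcc.eq, pow_succ a n, mul_assoc]
  · rw [key1, h0, mul_zero]

end Fitting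

/-! ### Summands of finite direct sums -/

section AddClosure

variable {C : Type u} [Category.{v} C] [Preadditive C]

/-- Writing the identity as a sum of endomorphisms through `U` turns membership in `add U` into an
equation, which additive functors preserve and which can be composed or corrected by an inverse. -/
lemma addClosure_of_sum [HasFiniteBiproducts C] {U Y : C} {ι : Type*} [Fintype ι] (i : ι → (Y ⟶ U))
    (r : ι → (U ⟶ Y)) (h : ∑ j, i j ≫ r j = 𝟙 Y) : addClosure U Y := by
  let e := Fintype.equivFin ι
  refine ⟨Fintype.card ι, ⟨⟨
    biproduct.lift fun j => i (e.symm j), biproduct.desc fun j => r (e.symm j), ?_⟩⟩⟩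
  rw [biproduct.lift_desc, ← h]
  exact Fintype.sum_equiv e.symm _ _ fun _ => rfl

lemma exists_sum_of_addClosure [HasFiniteBiproducts C] {U Y : C} (h : addClosure U Y) :
    ∃ (n : ℕ) (i : Fin n → (Y ⟶ U)) (r : Fin n → (U ⟶ Y)), ∑ j, i j ≫ r j = 𝟙 Y := by
  obtain ⟨n, ⟨ρ⟩⟩ := h
  refine ⟨n, fun j => ρ.i ≫ biproduct.π _ j, fun j => biproduct.ι (fun _ => U) j ≫ ρ.r, ?_⟩
  have : ∀ j, (ρ.i ≫ biproduct.π (fun _ => U) j) ≫ biproduct.ι (fun _ => U) j ≫ ρ.r =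
      ρ.i ≫ (biproduct.π (fun _ => U) j ≫ biproduct.ι (fun _ => U) j) ≫ ρ.r := fun j => by
    simp only [Category.assoc]
  simp_rw [this]
  rw [← Preadditive.comp_sum, ← Preadditive.sum_comp, biproduct.total, Category.id_comp, ρ.retract]

variable [HasFiniteBiproducts C]

lemma addClosure_self (U : C) : addClosure U U :=
  addClosure_of_sum (ι := Unit) (fun _ => 𝟙 U) (fun _ => 𝟙 U) (by simp)

lemma addClosure_of_isZero (U : C) {Y : C} (h : IsZero Y) : addClosure U Y :=
  addClosure_of_sum (ι := Empty) (fun j => j.elim) (fun j => j.elim) (h.eq_of_src _ _)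

lemma addClosure_trans {U V Y : C} (h : addClosure V U) (h' : addClosure U Y) : addClosure V Y := by
  obtain ⟨n, i, r, e⟩ := exists_sum_of_addClosure h
  obtain ⟨m, i', r', e'⟩ := exists_sum_of_addClosure h'
  refine addClosure_of_sum (ι := Fin m × Fin n) (fun j => i' j.1 ≫ i j.2)
    (fun j => r j.2 ≫ r' j.1) ?_
  rw [Fintype.sum_prod_type, ← e']
  refine Finset.sum_congr rfl fun j _ => ?_
  calc ∑ l, (i' j ≫ i l) ≫ r l ≫ r' j = ∑ l, i' j ≫ (i l ≫ r l) ≫ r' j := by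
        simp only [Category.assoc]
    _ = i' j ≫ (∑ l, i l ≫ r l) ≫ r' j := by
        rw [Preadditive.sum_comp, Preadditive.comp_sum]
    _ = i' j ≫ r' j := by rw [e, Category.id_comp]

lemma addClosure_of_retract {U Y Z : C} (h : addClosure U Y) (ρ : Retract Z Y) : addClosure U Z :=
  addClosure_trans h (addClosure_of_sum (ι := Unit) (fun _ => ρ.i) (fun _ => ρ.r) (by simp))

lemma addClosure_of_iso {U Y Z : C} (h : addClosure U Y) (e : Y ≅ Z) : addClosure U Z :=
  addClosure_of_retract h (Retract.ofIso e.symm)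

lemma addClosure_biprod [HasBinaryBiproducts C] {U Y Z : C} (h : addClosure U Y)
    (h' : addClosure U Z) : addClosure U (Y ⊞ Z) := by
  obtain ⟨n, i, r, e⟩ := exists_sum_of_addClosure h
  obtain ⟨m, i', r', e'⟩ := exists_sum_of_addClosure h'
  refine addClosure_of_sum (ι := Fin n ⊕ Fin m)
    (Sum.elim (fun j => biprod.fst ≫ i j) (fun j => biprod.snd ≫ i' j))
    (Sum.elim (fun j => r j ≫ biprod.inl) (fun j => r' j ≫ biprod.inr)) ?_
  rw [Fintype.sum_sum_type]
  have h1 : ∑ j, (biprod.fst ≫ i j) ≫ r j ≫ biprod.inl =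
      (biprod.fst : Y ⊞ Z ⟶ Y) ≫ (biprod.inl : Y ⟶ Y ⊞ Z) := by
    have : ∀ j, (biprod.fst ≫ i j) ≫ r j ≫ (biprod.inl : Y ⟶ Y ⊞ Z) =
      (biprod.fst : Y ⊞ Z ⟶ Y) ≫ (i j ≫ r j) ≫ biprod.inl := fun j => by simp only [Category.assoc]
    simp_rw [this]
    rw [← Preadditive.comp_sum, ← Preadditive.sum_comp, e, Category.id_comp]
  have h2 : ∑ j, (biprod.snd ≫ i' j) ≫ r' j ≫ biprod.inr =
      (biprod.snd : Y ⊞ Z ⟶ Z) ≫ (biprod.inr : Z ⟶ Y ⊞ Z) := by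
    have : ∀ j, (biprod.snd ≫ i' j) ≫ r' j ≫ (biprod.inr : Z ⟶ Y ⊞ Z) =
      (biprod.snd : Y ⊞ Z ⟶ Z) ≫ (i' j ≫ r' j) ≫ biprod.inr := fun j => by
        simp only [Category.assoc]
    simp_rw [this]
    rw [← Preadditive.comp_sum, ← Preadditive.sum_comp, e', Category.id_comp]
  exact (congrArg₂ (· + ·) h1 h2).trans biprod.total

lemma addClosure_map {D : Type*} [Category D] [Preadditive D] [HasFiniteBiproducts D] (G : C ⥤ D)
    [G.Additive] {U Y : C} (h : addClosure U Y) : addClosure (G.obj U) (G.obj Y) := by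
  obtain ⟨n, i, r, e⟩ := exists_sum_of_addClosure h
  refine addClosure_of_sum (fun j => G.map (i j)) (fun j => G.map (r j)) ?_
  simp_rw [← G.map_comp]
  rw [← G.map_sum, e, G.map_id]

end AddClosure

/-! ### Objects without common summands -/

section RadPair

lemma isIso_of_isIso_comp_comp {C : Type u} [Category.{v} C] {X Y : C}
    (f : X ⟶ Y) (g : Y ⟶ X) (h : IsIso (f ≫ g))
    (h' : IsIso (g ≫ f)) : IsIso f := by
  refine ⟨g ≫ inv (f ≫ g), by rw [← Category.assoc, IsIso.hom_inv_id], ?_⟩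
  have h1 : (inv (g ≫ f) ≫ g) ≫ f = 𝟙 Y := by rw [Category.assoc, IsIso.inv_hom_id]
  have h2 : f ≫ (g ≫ inv (f ≫ g)) = 𝟙 X := by rw [← Category.assoc, IsIso.hom_inv_id]
  have h3 : g ≫ inv (f ≫ g) = inv (g ≫ f) ≫ g := by
    rw [← Category.id_comp (g ≫ inv (f ≫ g)), ← h1, Category.assoc, h2, Category.comp_id]
  rw [h3, h1]

variable {C : Type u} [Category.{v} C] [Preadditive C]

/-- Jacobson's identity: if `c` is inverse to `1 - uv`, then `1 + vcu` is inverse to `1 - vu`. -/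
lemma isIso_id_sub_comp_swap {W X : C} (u : W ⟶ X) (v : X ⟶ W) (h : IsIso (𝟙 W - u ≫ v)) :
    IsIso (𝟙 X - v ≫ u) := by
  have h1 := IsIso.hom_inv_id (𝟙 W - u ≫ v)
  have h2 := IsIso.inv_hom_id (𝟙 W - u ≫ v)
  generalize inv (𝟙 W - u ≫ v) = c at h1 h2
  have h1' : u ≫ v ≫ c = c - 𝟙 W := by
    rw [← h1]; simp
  have h2' : c ≫ u ≫ v = c - 𝟙 W := by
    rw [← h2]; simp
  refine ⟨𝟙 X + v ≫ c ≫ u, ?_, ?_⟩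
  · have : (v ≫ u) ≫ v ≫ c ≫ u = v ≫ (u ≫ v ≫ c) ≫ u := by simp only [Category.assoc]
    rw [Preadditive.sub_comp, Preadditive.comp_add, Preadditive.comp_add, this, h1']
    simp
  · have : (v ≫ c ≫ u) ≫ v ≫ u = v ≫ (c ≫ u ≫ v) ≫ u := by simp only [Category.assoc]
    rw [Preadditive.comp_sub, Preadditive.add_comp, Preadditive.add_comp, this, h2']
    simp

/-- All endomorphisms of `W` that factor through `X` are in the radical. -/
def RadPair (W X : C) : Prop := ∀ (u : W ⟶ X) (v : X ⟶ W), IsIso (𝟙 W - u ≫ v)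

lemma RadPair.symm {W X : C} (h : RadPair W X) : RadPair X W := fun u v =>
  isIso_id_sub_comp_swap v u (h v u)

/-- Sums of radical endomorphisms stay radical: with `a` the difference for the smaller sum, `a - uv
= a (1 - a⁻¹uv)`, and the second factor is again of the form covered by `RadPair`. -/
lemma RadPair.isIso_id_sub_sum {W X : C} (h : RadPair W X) {ι : Type*} (s : Finset ι)
    (u : ι → (W ⟶ X)) (v : ι → (X ⟶ W)) : IsIso (𝟙 W - ∑ j ∈ s, u j ≫ v j) := by
  classical
  induction s using Finset.induction_on with
  | empty => rw [Finset.sum_empty, sub_zero]; infer_instance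
  | insert j s hj ih =>
    have h1 := h (inv (𝟙 W - ∑ j ∈ s, u j ≫ v j) ≫ u j) (v j)
    have : 𝟙 W - ∑ j ∈ insert j s, u j ≫ v j = (𝟙 W - ∑ j ∈ s, u j ≫ v j) ≫
        (𝟙 W - (inv (𝟙 W - ∑ j ∈ s, u j ≫ v j) ≫ u j) ≫ v j) := by
      rw [Finset.sum_insert hj, Preadditive.comp_sub, Category.comp_id, Category.assoc,
        IsIso.hom_inv_id_assoc]
      abel
    rw [this]
    infer_instance

/-- Cancellation of summands. -/
lemma nonempty_iso_of_biprod_iso [HasBinaryBiproducts C] {X' X'' Y' Y'' : C}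
    (e : X' ⊞ X'' ≅ Y' ⊞ Y'') (h : RadPair X'' Y') (h' : RadPair Y'' X') :
    Nonempty (X'' ≅ Y'') := by
  -- The identity of `X''` is the sum of its paths through `Y'` and `Y''`. The path through `Y'` is
  -- radical, so the other one is invertible. Applying this to `e` and to its inverse makes both
  -- composites of the diagonal components invertible.
  have key : ∀ {X' X'' Y' Y'' : C} (e : X' ⊞ X'' ≅ Y' ⊞ Y''), RadPair X'' Y' →
      IsIso ((biprod.inr ≫ e.hom ≫ biprod.snd : X'' ⟶ Y'') ≫ biprod.inr ≫ e.inv ≫ biprod.snd) := by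
    intro X' X'' Y' Y'' e h
    have h1 := h (biprod.inr ≫ e.hom ≫ biprod.fst) (biprod.inl ≫ e.inv ≫ biprod.snd)
    have : 𝟙 X'' - (biprod.inr ≫ e.hom ≫ biprod.fst) ≫ biprod.inl ≫ e.inv ≫ biprod.snd =
        (biprod.inr ≫ e.hom ≫ biprod.snd) ≫ biprod.inr ≫ e.inv ≫ biprod.snd := by
      have := congrArg (fun t => biprod.inr ≫ e.hom ≫ t ≫ e.inv ≫ biprod.snd)
        (biprod.total (X := Y') (Y := Y''))
      simp only [Preadditive.add_comp, Preadditive.comp_add, Category.assoc, Category.id_comp,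
        e.hom_inv_id_assoc, biprod.inr_snd] at this
      rw [sub_eq_iff_eq_add', ← this]
      simp only [Category.assoc]
    rwa [this] at h1
  have := isIso_of_isIso_comp_comp _ _ (key e h) (key e.symm h')
  exact ⟨asIso (biprod.inr ≫ e.hom ≫ biprod.snd)⟩

variable [HasFiniteBiproducts C]

lemma RadPair.of_addClosure {W X Y : C} (h : RadPair W X) (hY : addClosure X Y) : RadPair W Y := by
  intro u v
  obtain ⟨n, i, r, e⟩ := exists_sum_of_addClosure hY
  have : u ≫ v = ∑ j, (u ≫ i j) ≫ r j ≫ v := by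
    have : ∀ j, (u ≫ i j) ≫ r j ≫ v = u ≫ (i j ≫ r j) ≫ v := fun j => by
      simp only [Category.assoc]
    simp_rw [this]
    rw [← Preadditive.comp_sum, ← Preadditive.sum_comp, e, Category.id_comp]
  rw [this]
  exact h.isIso_id_sub_sum _ _ _

lemma RadPair.of_addClosure_left {W X Y : C} (h : RadPair W X) (hY : addClosure W Y) :
    RadPair Y X := (h.symm.of_addClosure hY).symm

/-- `X` has no nonzero summands in `add U`. -/
def IsReduced (U X : C) : Prop := ∀ Z : C, addClosure U Z → Nonempty (Retract Z X) → IsZero Z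

/-- In a decomposition of the identity of `W`, the part through `X` is radical, so the part through
`Y` is invertible; its inverse is absorbed into the second maps. -/
lemma addClosure_of_addClosure_biprod [HasBinaryBiproducts C] {W X Y : C} (h : RadPair W X)
    (hW : addClosure (X ⊞ Y) W) : addClosure Y W := by
  obtain ⟨n, i, r, e⟩ := exists_sum_of_addClosure hW
  have h1 := h.isIso_id_sub_sum Finset.univ (fun j => i j ≫ biprod.fst) (fun j => biprod.inl ≫ r j)
  have h2 : 𝟙 W - ∑ j, (i j ≫ biprod.fst) ≫ biprod.inl ≫ r j =
      ∑ j, (i j ≫ biprod.snd) ≫ biprod.inr ≫ r j := by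
    rw [sub_eq_iff_eq_add', ← e, ← Finset.sum_add_distrib]
    refine Finset.sum_congr rfl fun j _ => ?_
    have := congrArg (fun t => i j ≫ t ≫ r j) (biprod.total (X := X) (Y := Y))
    simp only [Preadditive.add_comp, Preadditive.comp_add, Category.assoc, Category.id_comp]
      at this ⊢
    exact this.symm
  rw [h2] at h1
  refine addClosure_of_sum (fun j => i j ≫ biprod.snd)
    (fun j => biprod.inr ≫ r j ≫ inv (∑ j, (i j ≫ biprod.snd) ≫ biprod.inr ≫ r j)) ?_
  have h3 := IsIso.hom_inv_id (∑ j, (i j ≫ biprod.snd) ≫ biprod.inr ≫ r j)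
  refine Eq.trans ?_ h3
  conv_rhs => rw [Preadditive.sum_comp]
  simp only [Category.assoc]

/-- This replaces Krull-Schmidt arguments. If `uv` were not nilpotent, Fitting's lemma would give a
nonzero idempotent factoring through `X`, whose image would be a summand of `X` lying in `add U`.
Hence `uv` is nilpotent and `1 - uv` is a unit. -/
lemma IsReduced.radPair (k : Type w) [Field k] [Linear k C] [IsIdempotentComplete C]
    {U X W : C} [Module.Finite k (W ⟶ W)]
    (h : IsReduced U X) (hW : addClosure U W) : RadPair W X := by
  intro u v
  have : Module.Finite k (End W) := ‹Module.Finite k (W ⟶ W)›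
  -- Multiplication in `End` is composition in reverse order, so `e = b * (u ≫ v)` means that `e`
  -- starts with `u`, as needed to factor the image of `e` through `X`.
  obtain ⟨e, b, he, hb, hn⟩ := exists_idempotent_multiple k (A := End W) (u ≫ v)
  obtain ⟨Z, i, p, hip, hpi⟩ := IsIdempotentComplete.idempotents_split W e he
  have hb' : e = (u ≫ v) ≫ b := hb
  have hZ : IsZero Z := by
    refine h Z (addClosure_of_retract hW ⟨i, p, hip⟩) ⟨⟨i ≫ u, v ≫ b ≫ p, ?_⟩⟩
    have : (i ≫ u) ≫ v ≫ b ≫ p = i ≫ ((u ≫ v) ≫ b) ≫ p := by simp only [Category.assoc]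
    rw [this, ← hb', ← hpi, Category.assoc, hip, Category.comp_id, hip]
  have he0 : e = 0 := by rw [← hpi, hZ.eq_of_tgt p 0, zero_comp]
  have := (hn he0).isUnit_one_sub
  exact (isUnit_iff_isIso _).1 this

/-- Splitting off a nonzero summand in `add U` lowers the dimension of the endomorphism algebra, so
the process stops. -/
lemma exists_biprod_isReduced (k : Type w) [Field k] [Linear k C] [HasBinaryBiproducts C]
    [IsIdempotentComplete C]
    (hfin : ∀ X : C, Module.Finite k (X ⟶ X)) (U X : C) :
    ∃ X' X'' : C, Nonempty (X ≅ X' ⊞ X'') ∧ IsReduced U X' ∧ addClosure U X'' := by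
  induction hn : Module.finrank k (X ⟶ X) using Nat.strong_induction_on generalizing X with
  | _ n ih =>
  obtain ⟨O, hO⟩ := (hasZeroObject_of_hasFiniteBiproducts C).zero
  by_cases hX : IsReduced U X
  · exact ⟨X, O, ⟨isoBiprodZero hO⟩, hX, addClosure_of_isZero U hO⟩
  simp only [IsReduced, not_forall] at hX
  obtain ⟨Z, hZ, ⟨ρ⟩, hZ0⟩ := hX
  obtain ⟨Y, i, p, hip, hpi⟩ := IsIdempotentComplete.idempotents_split X (𝟙 X - ρ.r ≫ ρ.i) (by
    have : (ρ.r ≫ ρ.i) ≫ ρ.r ≫ ρ.i = ρ.r ≫ ρ.i := by simp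
    rw [Preadditive.comp_sub, Preadditive.sub_comp, Preadditive.sub_comp, this]; simp)
  have hiZ : ρ.i ≫ p = 0 := by
    have : ρ.i ≫ p ≫ i ≫ p = 0 := by
      rw [← Category.assoc p, hpi]; simp
    rwa [hip, Category.comp_id] at this
  have hiY : i ≫ ρ.r = 0 := by
    have : (i ≫ p ≫ i) ≫ ρ.r = 0 := by
      rw [hpi]; simp
    rwa [← Category.assoc i, hip, Category.id_comp] at this
  have hlt : Module.finrank k (Y ⟶ Y) < n := by
    let φ : (Y ⟶ Y) →ₗ[k] (X ⟶ X) := (Linear.leftComp k X p).comp (Linear.rightComp k Y i)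
    have hφ : ∀ g, φ g = p ≫ g ≫ i := fun g => rfl
    have hinj : Function.Injective φ := by
      intro g g' hgg
      have := congrArg (fun t => i ≫ t ≫ p) hgg
      simp only [hφ, Category.assoc, hip, Category.comp_id] at this
      rwa [← Category.assoc, ← Category.assoc, hip, Category.id_comp, Category.id_comp] at this
    have hfX := hfin X
    -- With equal dimensions, `g ↦ p ≫ g ≫ i` would be onto and the identity of `X` would factor
    -- through `p`. As `ρ.i ≫ p = 0`, the summand `Z` would be zero.
    refine lt_of_le_of_ne (hn ▸ LinearMap.finrank_le_finrank_of_injective hinj) fun heq => hZ0 ?_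
    have hfY := hfin Y
    obtain ⟨g, hg⟩ := (LinearMap.injective_iff_surjective_of_finrank_eq_finrank
      (heq.trans hn.symm)).1 hinj (𝟙 X)
    rw [IsZero.iff_id_eq_zero, ← ρ.retract, ← Category.comp_id ρ.i, ← hg, hφ, reassoc_of% hiZ]
    simp
  obtain ⟨Y', Y'', ⟨e⟩, h1, h2⟩ := ih _ hlt Y rfl
  refine ⟨Y', Y'' ⊞ Z, ⟨?_⟩, h1, addClosure_biprod h2 hZ⟩
  refine ⟨biprod.lift (p ≫ e.hom ≫ biprod.fst) (biprod.lift (p ≫ e.hom ≫ biprod.snd) ρ.r),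
    biprod.desc (biprod.inl ≫ e.inv ≫ i) (biprod.desc (biprod.inr ≫ e.inv ≫ i) ρ.i), ?_, ?_⟩
  · have := congrArg (fun t => p ≫ e.hom ≫ t ≫ e.inv ≫ i) (biprod.total (X := Y') (Y := Y''))
    simp only [Preadditive.add_comp, Preadditive.comp_add, Category.assoc, Category.id_comp,
        e.hom_inv_id_assoc, hpi] at this
    simp only [biprod.lift_desc, Category.assoc]
    rw [← add_assoc, this, sub_add_cancel]
  · ext <;> simp [hiY, reassoc_of% hip, reassoc_of% hiZ, ρ.retract]

end RadPair

/-! ### Exactness of `(d+2)`-angles -/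

section Exactness

variable {C : Type u} [Category.{v} C] [Preadditive C]

/-- `f` is a weak kernel of `g`, and `g` is a weak cokernel of `f`. -/
structure WeakExact {X Y Z : C} (f : X ⟶ Y) (g : Y ⟶ Z) : Prop where
  zero : f ≫ g = 0
  lift : ∀ {W : C} (h : W ⟶ Y), h ≫ g = 0 → ∃ l, l ≫ f = h
  desc : ∀ {W : C} (h : Y ⟶ W), f ≫ h = 0 → ∃ l, g ≫ l = h

lemma WeakExact.of_zsmul {X Y Z : C} {f : X ⟶ Y} {g : Y ⟶ Z} (n : ℕ)
    (h : WeakExact f (((-1 : ℤ) ^ n) • g)) : WeakExact f g := by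
  rcases neg_one_pow_eq_or ℤ n with hn | hn
  · rwa [hn, one_smul] at h
  · rw [hn, neg_smul, one_smul] at h
    refine ⟨by simpa using h.zero, fun l hl => h.lift l (by simpa using hl), fun l hl => ?_⟩
    obtain ⟨m, hm⟩ := h.desc l hl
    exact ⟨-m, by simpa using hm⟩

variable [HasBinaryBiproducts C] {Sus : C ≌ C} {d : ℕ}

lemma Angulation.exists_trivial [HasZeroObject C] (A : Angulation Sus d) (Z : C) :
    ∃ S : SusSeq Sus d, A.angle S ∧ (∀ i : Fin (d + 2), i.val < d → IsZero (S.obj i)) ∧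
      IsIso S.firstMap ∧ Nonempty (S.fst ≅ Z) := by
  have := HasZeroObject.zero' C
  obtain ⟨O, hO⟩ := HasZeroObject.zero (C := C)
  let S : SusSeq Sus d :=
    { obj := fun i => if i.val < d then O else Z
      map := fun i => if h : i.val < d then 0 else
        eqToHom (by
          rw [if_neg, if_neg]
          · simpa using h
          · simp only [Fin.val_succ]; omega)
      close := 0 }
  have h1 : IsIso S.firstMap := by
    have : S.firstMap = eqToHom _ := dif_neg (by simp)
    rw [this]
    infer_instance
  have h2 : ∀ i : Fin (d + 2), i.val < d → IsZero (S.obj i) := fun i hi => by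
    have : S.obj i = O := if_pos hi
    rwa [this]
  exact ⟨S, A.angle_trivial S h1 h2, h2, h1, ⟨eqToIso (if_neg (by simp))⟩⟩

/-- This is the angle `0 ⟶ Z = Z ⟶ 0 ⟶ ⋯`, obtained because its rotation is a trivial angle; it is
the test object for weak cokernels. -/
lemma Angulation.exists_trivial' [HasZeroObject C] [Sus.functor.Additive]
    (A : Angulation Sus (d + 1))
    (Z : C) : ∃ S : SusSeq Sus (d + 1), A.angle S ∧ IsIso (S.map (Fin.last d).castSucc) ∧
      Nonempty (S.snd ≅ Z) := by
  obtain ⟨O, hO⟩ := HasZeroObject.zero (C := C)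
  let S : SusSeq Sus (d + 1) :=
    { obj := fun i => if i.val = d + 2 ∨ i.val < d then O else Z
      map := fun i => if h : i.val = d then
          eqToHom (by
            rw [if_neg, if_neg]
            · simp only [Fin.val_castSucc]; omega
            · simp only [Fin.val_succ]; omega)
        else 0
      close := 0 }
  have h1 : IsIso (S.map (Fin.last d).castSucc) := by
    have : S.map (Fin.last d).castSucc = eqToHom _ := dif_pos (by simp)
    rw [this]
    infer_instance
  have h2 : ∀ i : Fin (d + 3), i.val = d + 2 ∨ i.val < d → IsZero (S.obj i) := fun i hi => by
    have : S.obj i = O := if_pos hi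
    rwa [this]
  refine ⟨S, (A.angle_rotate_iff S).1 (A.angle_trivial _ h1 fun i => ?_), h1,
    ⟨eqToIso (if_neg ?_)⟩⟩
  · induction i using Fin.cases with
    | zero => exact fun _ => Sus.functor.map_isZero (h2 _ (Or.inl (by simp)))
    | succ i => exact fun hi => h2 _ (Or.inr (by simpa using hi))
  · simp

variable [HasZeroObject C] [Sus.functor.Additive]

/-- Each property comes from a morphism between the given angle and a trivial one. Only rotation and
the extension of commutative squares are needed; the mapping cone plays no role. -/
lemma Angulation.weakExact_first (A : Angulation Sus (d + 1)) {S : SusSeq Sus (d + 1)}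
    (hS : A.angle S) : WeakExact (S.map (Fin.last d).succ) (S.map (Fin.last d).castSucc) := by
  refine ⟨?_, fun {W} h hh => ?_, fun {W} h hh => ?_⟩
  · obtain ⟨S', hS', h0, hiso, ⟨a⟩⟩ := A.exists_trivial S.fst
    obtain ⟨φ, h1, h2, -⟩ := A.exists_hom S' S hS' hS a.hom (inv S'.firstMap ≫ a.hom ≫ S.firstMap)
      (by simp)
    have h3 := φ.comm (Fin.last d).castSucc
    have h4 : S'.map (Fin.last d).castSucc = 0 := (h0 _ (by simp)).eq_of_tgt _ _
    rw [h4, zero_comp] at h3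
    have h5 : (inv S'.firstMap ≫ a.hom ≫ S.firstMap) ≫ S.map (Fin.last d).castSucc = 0 := by
      rw [← h2]; exact h3.symm
    have h6 := congrArg (fun t => a.inv ≫ S'.firstMap ≫ t) h5
    simpa using h6
  -- After rotating both angles, the map `W ⟶ S.snd` and the zero map form a square between first
  -- morphisms. The last component of its extension is a morphism between suspensions, and its
  -- desuspension is the lift; the rotation signs on both sides cancel.
  · obtain ⟨S', hS', h0, hiso, ⟨a⟩⟩ := A.exists_trivial W
    have hr' := (A.angle_rotate_iff S').2 hS'
    have hr := (A.angle_rotate_iff S).2 hS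
    let x : S'.snd ⟶ S.snd := inv S'.firstMap ≫ a.hom ≫ h
    have hx : S'.firstMap ≫ x = a.hom ≫ h := IsIso.hom_inv_id_assoc _ _
    obtain ⟨φ, h1, h2, -⟩ := A.exists_hom _ _ hr' hr x 0 (by
      rw [comp_zero]
      change 0 = x ≫ S.map (Fin.last d).castSucc
      rw [← cancel_epi S'.firstMap, reassoc_of% hx, hh]
      simp)
    obtain ⟨ψ, hψ⟩ : ∃ ψ : Sus.functor.obj S'.fst ⟶ Sus.functor.obj S.fst, ψ = φ.app 0 := ⟨_, rfl⟩
    have h4 : (((-1 : ℤ) ^ (d + 1 + 2)) • Sus.functor.map S'.firstMap) ≫ Sus.functor.map x =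
        ψ ≫ (((-1 : ℤ) ^ (d + 1 + 2)) • Sus.functor.map S.firstMap) := by
      rw [← h1, hψ]; exact φ.comm_close
    have h5 : Sus.functor.map S'.firstMap ≫ Sus.functor.map x = ψ ≫ Sus.functor.map S.firstMap := by
      rw [Preadditive.zsmul_comp, Preadditive.comp_zsmul] at h4
      rcases neg_one_pow_eq_or ℤ (d + 1 + 2) with hn | hn
      · rwa [hn, one_smul, one_smul] at h4
      · rwa [hn, neg_smul, neg_smul, one_smul, one_smul, neg_inj] at h4
    rw [← Functor.map_comp, hx] at h5
    refine ⟨a.inv ≫ Sus.functor.preimage ψ, Sus.functor.map_injective ?_⟩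
    have h6 : Sus.functor.map (Sus.functor.preimage ψ) ≫ Sus.functor.map S.firstMap =
        Sus.functor.map (a.hom ≫ h) := by
      rw [h5, Functor.map_preimage]
    change Sus.functor.map ((_ ≫ _) ≫ S.firstMap) = _
    rw [Category.assoc, Functor.map_comp, Functor.map_comp, h6, ← Functor.map_comp]
    simp
  · obtain ⟨S', hS', hiso, ⟨b⟩⟩ := A.exists_trivial' W
    obtain ⟨φ, h1, h2, -⟩ := A.exists_hom S S' hS hS' 0 (h ≫ b.inv) (by
      change S.map (Fin.last d).succ ≫ _ = _
      rw [reassoc_of% hh]; simp)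
    have h3 : S.map (Fin.last d).castSucc ≫ φ.app _ =
      (h ≫ b.inv) ≫ S'.map (Fin.last d).castSucc := by
      rw [← h2]
      exact φ.comm (Fin.last d).castSucc
    refine ⟨φ.app _ ≫ inv (S'.map (Fin.last d).castSucc) ≫ b.hom, ?_⟩
    rw [reassoc_of% h3, IsIso.hom_inv_id_assoc]
    simp

/-- Rotation moves each map one place nearer to the first position, where exactness is known. -/
lemma Angulation.weakExact_map (A : Angulation Sus (d + 1)) {S : SusSeq Sus (d + 1)}
    (hS : A.angle S) (i : Fin (d + 1)) : WeakExact (S.map i.succ) (S.map i.castSucc) := by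
  induction i using Fin.reverseInduction generalizing S with
  | last => exact A.weakExact_first hS
  | cast i ih => exact ih ((A.angle_rotate_iff S).2 hS)

lemma Angulation.weakExact_zero (A : Angulation Sus (d + 1)) {S : SusSeq Sus (d + 1)}
    (hS : A.angle S) : WeakExact (S.map 0) S.close :=
  A.weakExact_map ((A.angle_rotate_iff S).2 hS) 0

lemma Angulation.weakExact_close (A : Angulation Sus (d + 1)) {S : SusSeq Sus (d + 1)}
    (hS : A.angle S) : WeakExact S.close (Sus.functor.map S.firstMap) :=
  (A.weakExact_zero ((A.angle_rotate_iff S).2 hS)).of_zsmul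

end Exactness

/-! ### Maps into the Nakayama functor -/

section NakayamaDuality

lemma exists_dual_basis (R : Type*) [Ring R] (P : Type*) [AddCommGroup P] [Module R P]
    [Module.Finite R P] [Module.Projective R P] :
    ∃ (n : ℕ) (x : Fin n → P) (x' : Fin n → (P →ₗ[R] R)), ∀ p, ∑ l, x' l p • x l = p := by
  obtain ⟨n, π, hπ⟩ := Module.Finite.exists_fin' R P
  obtain ⟨s, hs⟩ := Module.projective_lifting_property π LinearMap.id hπ
  refine ⟨n, fun l => π (Pi.single l 1), fun l => (LinearMap.proj l).comp s, fun p => ?_⟩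
  have h1 : π (s p) = p := LinearMap.congr_fun hs p
  conv_rhs => rw [← h1, ← Finset.univ_sum_single (s p), map_sum]
  refine Finset.sum_congr rfl fun l _ => ?_
  rw [← map_smul, ← Pi.single_smul, smul_eq_mul, mul_one]
  rfl

variable {k : Type w} [Field k] {R : Type v} [Ring R] [Algebra k R]
  {M : Type v} [AddCommGroup M] [Module R M]

/-- This is one half of `Hom(M, νP) ≅ D Hom(P, M)`: the form `Θ` is a trace over a dual basis of
`P`. Additivity of `Θ` suffices for the later use. -/
lemma nakayama_map_apply (P : Type v) [AddCommGroup P] [Module R P] [Module.Finite R P]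
    [Module.Projective R P] (f : M →ₗ[R] Nakayama k R P) :
    ∃ Θ : (P →ₗ[R] M) →+ k, ∀ (m : M) (g : P →ₗ[R] R),
      (f m).toDual g = Θ (g.smulRight m) := by
  obtain ⟨n, x, x', hx⟩ := exists_dual_basis R P
  refine ⟨AddMonoidHom.mk' (fun φ => ∑ l, (f (φ (x l))).toDual (x' l))
    fun φ φ' => ?_, fun m g => ?_⟩
  · rw [← Finset.sum_add_distrib]
    refine Finset.sum_congr rfl fun l _ => ?_
    rw [LinearMap.add_apply, map_add]
    rfl
  · have hg : g = ∑ l, rightMul k P (g (x l)) (x' l) := by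
      refine LinearMap.ext fun p => ?_
      conv_lhs => rw [← hx p, map_sum]
      rw [LinearMap.sum_apply]
      exact Finset.sum_congr rfl fun l _ => map_smul _ _ _
    conv_lhs => rw [hg, map_sum]
    refine Finset.sum_congr rfl fun l _ => ?_
    change (g (x l) • f m).toDual (x' l) = _
    rw [← map_smul]
    rfl

lemma sum_comp_smulRight_eq {P Q : Type v} [AddCommGroup P] [Module R P] [AddCommGroup Q]
    [Module R Q] {n : ℕ} {x : Fin n → Q} {x' : Fin n → (Q →ₗ[R] R)}
    (hx : ∀ p, ∑ l, x' l p • x l = p) (δ : P →ₗ[R] Q) (ψ : Q →ₗ[R] M) :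
    ψ.comp δ = ∑ l, ((x' l).comp δ).smulRight (ψ (x l)) := by
  refine LinearMap.ext fun p => ?_
  rw [LinearMap.comp_apply, LinearMap.sum_apply]
  conv_lhs => rw [← hx (δ p), map_sum]
  exact Finset.sum_congr rfl fun l _ => map_smul _ _ _

/-- `Hom(M, Ker(νP ⟶ νQ))` vanishes if and only if `Hom(Q, M) ⟶ Hom(P, M)` is surjective. -/
lemma hom_ker_nakayamaMap_vanishes_iff {P Q : Type v} [AddCommGroup P] [Module R P]
    [AddCommGroup Q] [Module R Q] [Module.Finite R P] [Module.Projective R P]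
    [Module.Finite R Q] [Module.Projective R Q] (δ : P →ₗ[R] Q) :
    (∀ f : M →ₗ[R] LinearMap.ker (nakayamaMap k δ), f = 0) ↔
      ∀ φ : P →ₗ[R] M, ∃ ψ : Q →ₗ[R] M, ψ.comp δ = φ := by
  constructor
  · intro h
    let _ : Module k M := Module.compHom M (algebraMap k R)
    have : IsScalarTower k R M := ⟨fun c r m => by
      rw [Algebra.smul_def, mul_smul]; rfl⟩
    have : SMulCommClass R k M := IsScalarTower.to_smulCommClass'
    let δ' : (Q →ₗ[R] M) →ₗ[k] (P →ₗ[R] M) :=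
      { toFun := fun g => g.comp δ
        map_add' := fun _ _ => rfl
        map_smul' := fun _ _ => rfl }
    suffices hs : Function.Surjective δ' from hs
    -- A form `θ` on `Hom(P, M)` that vanishes on the image of `Hom(Q, M)` defines `f m = (g ↦ θ (g
    -- · m))`, with values in the kernel. Since `f = 0` and the maps `g · m` span `Hom(P, M)`, one
    -- gets `θ = 0`.
    rw [← LinearMap.dualMap_injective_iff, injective_iff_map_eq_zero]
    intro θ hθ
    let ev : M →ₗ[k] (P →ₗ[R] R) →ₗ[k] (P →ₗ[R] M) := LinearMap.mk₂ k
      (fun m g => g.smulRight m)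
      (fun m m' g => LinearMap.ext fun p => smul_add _ _ _)
      (fun c m g => LinearMap.ext fun p => smul_comm _ _ _)
      (fun m g g' => LinearMap.ext fun p => add_smul _ _ _)
      (fun c m g => LinearMap.ext fun p => smul_assoc _ _ _)
    let f : M →ₗ[R] LinearMap.ker (nakayamaMap k δ) :=
      { toFun := fun m => ⟨θ.comp (ev m), LinearMap.ext fun g =>
          LinearMap.congr_fun hθ (g.smulRight m)⟩
        map_add' := fun m m' => Subtype.ext (LinearMap.ext fun g => by
          change θ (ev (m + m') g) = θ (ev m g) + θ (ev m' g)
          rw [map_add, LinearMap.add_apply, map_add])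
        map_smul' := fun r m => Subtype.ext (LinearMap.ext fun g => congrArg θ
          (LinearMap.ext fun p => (mul_smul (g p) r m).symm)) }
    have hf : ∀ m g, θ (ev m g) = 0 := fun m g => by
      have h1 : ((f m).1 : Nakayama k R P) = 0 := by rw [h f]; rfl
      exact LinearMap.congr_fun h1 g
    obtain ⟨n, x, x', hx⟩ := exists_dual_basis R P
    refine LinearMap.ext fun φ => ?_
    have hφ := sum_comp_smulRight_eq hx LinearMap.id φ
    rw [LinearMap.comp_id] at hφ
    rw [hφ, map_sum]
    exact Finset.sum_eq_zero fun l _ => hf _ _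
  · intro h f
    obtain ⟨Θ, hΘ⟩ := nakayama_map_apply P ((LinearMap.ker (nakayamaMap k δ)).subtype.comp f)
    obtain ⟨n, x, x', hx⟩ := exists_dual_basis R Q
    refine LinearMap.ext fun m => Subtype.ext (LinearMap.ext fun g => ?_)
    refine (hΘ m g).trans ?_
    -- It remains to see that `Θ` vanishes on `ψ.comp δ`. This is a sum of maps `(x' l ∘ δ) · ψ (x
    -- l)`, on which `Θ` is zero because `f` takes values in the kernel.
    obtain ⟨ψ, hψ⟩ := h (g.smulRight m)
    rw [← hψ, sum_comp_smulRight_eq hx, map_sum]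
    refine Finset.sum_eq_zero fun l _ => ?_
    rw [← hΘ]
    exact LinearMap.congr_fun (f (ψ (x l))).2 (x' l)

end NakayamaDuality

/-! ### Minimal resolutions -/

section Cover

variable (R : Type v) [Ring R]

/-- The cover is a minimal projective submodule `L` of a free module that still maps onto `M`. If
`K` and the kernel generate `L`, lifting gives an endomorphism `h` of `L` over `M` with image in
`K`. By Fitting, a high power of `h` has as image a projective summand mapping onto `M`, which by
minimality is `L`; so `K` is everything. -/
lemma exists_projective_cover [IsNoetherianRing R] [IsArtinianRing R] (M : ModuleCat.{v} R)
    [Module.Finite R M] : ∃ (P : ModuleCat.{v} R) (ε : P →ₗ[R] M), Module.Finite R P ∧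
      Module.Projective R P ∧ Function.Surjective ε ∧ IsSuperfluous (LinearMap.ker ε) := by
  obtain ⟨n, π, hπ⟩ := Module.Finite.exists_fin' R M
  let 𝓛 : Set (Submodule R (Fin n → R)) := {L | Module.Projective R L ∧ L.map π = ⊤}
  have hne : 𝓛.Nonempty := ⟨⊤, Module.Projective.of_equiv (Submodule.topEquiv (R := R)).symm, by
    rw [Submodule.map_top, LinearMap.range_eq_top.2 hπ]⟩
  obtain ⟨L, ⟨hLp, hLt⟩, hmin⟩ := (wellFounded_lt (α := Submodule R (Fin n → R))).has_min 𝓛 hne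
  let ε : L →ₗ[R] M := π.comp L.subtype
  have hε : Function.Surjective ε := by
    rw [← LinearMap.range_eq_top, LinearMap.range_comp, Submodule.range_subtype, hLt]
  refine ⟨ModuleCat.of R L, ε, inferInstance, hLp, hε, fun K hK => ?_⟩
  have hK' : Function.Surjective (ε.comp K.subtype) := by
    intro m
    obtain ⟨x, rfl⟩ := hε m
    have hx : x ∈ LinearMap.ker ε ⊔ K := by rw [hK]; trivial
    obtain ⟨y, hy, z, hz, rfl⟩ := Submodule.mem_sup.1 hx
    refine ⟨⟨z, hz⟩, ?_⟩
    rw [map_add, LinearMap.mem_ker.1 hy, zero_add]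
    rfl
  obtain ⟨s, hs⟩ := Module.projective_lifting_property (ε.comp K.subtype) ε hK'
  let h : Module.End R L := K.subtype.comp s
  have hεh : ∀ x, ε (h x) = ε x := LinearMap.congr_fun hs
  have hεp : ∀ (m : ℕ) x, ε ((h ^ m) x) = ε x := by
    intro m
    induction m with
    | zero => intro x; rfl
    | succ m ih => intro x; rw [pow_succ, Module.End.mul_apply, ih, hεh]
  obtain ⟨N, hN⟩ := Filter.eventually_atTop.1 h.eventually_isCompl_ker_pow_range_pow
  -- The exponent is positive, so the image of the power lies in the image of `h`, hence in `K`.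
  have hcompl := hN (N + 1) (Nat.le_succ N)
  let L₁ := LinearMap.range (h ^ (N + 1))
  have hL₁ : Module.Projective R L₁ :=
    Module.Projective.of_split L₁.subtype (L₁.projectionOnto _ hcompl.symm)
      (LinearMap.ext fun x => Submodule.projectionOnto_apply_left hcompl.symm x)
  let L₂ := L₁.map L.subtype
  have hL₂ : L₂ ∈ 𝓛 := by
    refine ⟨Module.Projective.of_equiv (L₁.equivMapOfInjective L.subtype L.injective_subtype), ?_⟩
    rw [eq_top_iff]
    rintro m -
    obtain ⟨x, rfl⟩ := hε m
    exact ⟨_, ⟨_, ⟨x, rfl⟩, rfl⟩, hεp (N + 1) x⟩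
  have hle : L₂ ≤ L := Submodule.map_subtype_le _ _
  have heq : L₂ = L := by
    by_contra hne
    exact hmin L₂ hL₂ (lt_of_le_of_ne hle hne)
  rw [eq_top_iff]
  rintro x -
  have hx : (x : Fin n → R) ∈ L₂ := by rw [heq]; exact x.2
  obtain ⟨y, ⟨z, rfl⟩, hy⟩ := hx
  have : (h ^ (N + 1)) z = x := Subtype.ext hy
  rw [← this, pow_succ', Module.End.mul_apply]
  exact (s _).2

lemma nonempty_minimalResolution [IsNoetherianRing R] [IsArtinianRing R] (d : ℕ)
    (M : ModuleCat.{v} R) [hM : Module.Finite R M] :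
    Nonempty (MinimalResolution (R := R) d M) := by
  choose cov ε hfin hproj hsurj hsup using fun M : {M : ModuleCat.{v} R // Module.Finite R M} =>
    have := M.2; exists_projective_cover R M.1
  let K : ℕ → {M : ModuleCat.{v} R // Module.Finite R M} := fun n =>
    Nat.rec ⟨M, hM⟩ (fun _ N => ⟨ModuleCat.of R (LinearMap.ker (ε N)), by
      have := hfin N
      have := isNoetherian_of_isNoetherianRing_of_finite R (cov N)
      exact inferInstanceAs (Module.Finite R (LinearMap.ker (ε N)))⟩) n
  let δ : ∀ n, cov (K (n + 1)) →ₗ[R] cov (K n) := fun n =>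
    (LinearMap.ker (ε (K n))).subtype.comp (ε (K (n + 1)))
  have hker : ∀ n, LinearMap.ker (δ n) = LinearMap.ker (ε (K (n + 1))) := fun n =>
    LinearMap.ker_comp_of_ker_eq_bot _ (Submodule.ker_subtype _)
  have hrange : ∀ n, LinearMap.range (δ n) = LinearMap.ker (ε (K n)) := fun n =>
    (LinearMap.range_comp_of_range_eq_top _ (LinearMap.range_eq_top.2 (hsurj _))).trans
      (Submodule.range_subtype _)
  exact ⟨{
    P := fun n => cov (K n)
    δ := δ
    ε := ε (K 0)
    finite := fun i _ => hfin _
    projective := fun i _ => hproj _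
    surjective_ε := hsurj _
    exact_zero := fun _ => LinearMap.exact_iff.2 (hrange 0).symm
    exact_succ := fun i _ => LinearMap.exact_iff.2 ((hker i).trans (hrange (i + 1)).symm)
    superfluous_ε := hsup _
    superfluous_δ := fun i _ => by rw [hker]; exact hsup _ }⟩

end Cover

/-! ### Comparison of resolutions -/

section Comparison

/-- Dependent choice along `Fin`; the predicate `p` is the invariant that makes the next choice
possible. -/
lemma Fin.exists_dependent_seq {n : ℕ} {α : Fin (n + 1) → Type*} (p : ∀ i, α i → Prop)
    (r : ∀ i : Fin n, α i.castSucc → α i.succ → Prop) (a : α 0) (ha : p 0 a)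
    (h : ∀ (i : Fin n) (x : α i.castSucc), p _ x → ∃ y : α i.succ, p _ y ∧ r i x y) :
    ∃ f : ∀ i, α i, f 0 = a ∧ ∀ i : Fin n, r i (f i.castSucc) (f i.succ) := by
  choose y hy hr using h
  let F : ∀ i, {x : α i // p i x} := fun i =>
    Fin.induction (motive := fun i => {x : α i // p i x}) ⟨a, ha⟩
      (fun i x => ⟨y i x.1 x.2, hy i x.1 x.2⟩) i
  have h0 : F 0 = ⟨a, ha⟩ := rfl
  refine ⟨fun i => (F i).1, congrArg Subtype.val h0, fun i => ?_⟩
  have h1 : F i.succ = ⟨y i (F i.castSucc).1 (F i.castSucc).2, _⟩ := Fin.induction_succ _ _ _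
  change r i (F i.castSucc).1 (F i.succ).1
  rw [h1]
  exact hr i _ _

variable {R : Type v} [Ring R] {n : ℕ}

/-- The cycles of a complex `X_n ⟶ ⋯ ⟶ X_0`. -/
def cycles {X : Fin (n + 1) → ModuleCat.{v} R} (D : ∀ i : Fin n, X i.succ →ₗ[R] X i.castSucc)
    (i : Fin (n + 1)) :
    Submodule R (X i) :=
  Fin.cases (motive := fun i => Submodule R (X i)) ⊤ (fun i => LinearMap.ker (D i)) i

/-- `X_n ⟶ ⋯ ⟶ X_0` is the start of a resolution of `X_0`. -/
def IsAcyclic {X : Fin (n + 1) → ModuleCat.{v} R}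
    (D : ∀ i : Fin n, X i.succ →ₗ[R] X i.castSucc) : Prop :=
  ∀ i, LinearMap.range (D i) = cycles D i.castSucc

variable {X Y : Fin (n + 1) → ModuleCat.{v} R} {D : ∀ i : Fin n, X i.succ →ₗ[R] X i.castSucc}
  {E : ∀ i : Fin n, Y i.succ →ₗ[R] Y i.castSucc}

lemma IsAcyclic.map_mem (hD : IsAcyclic D) (i : Fin n) (x : X i.succ) :
    D i x ∈ cycles D i.castSucc := by
  rw [← hD i]; exact ⟨x, rfl⟩

lemma exists_lift_of_forall_mem_range {A B B' : Type*} [AddCommGroup A] [AddCommGroup B]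
    [AddCommGroup B']
    [Module R A] [Module R B] [Module R B'] [Module.Projective R A] (f : A →ₗ[R] B')
      (p : B →ₗ[R] B')
    (h : ∀ a, f a ∈ LinearMap.range p) : ∃ g : A →ₗ[R] B, p.comp g = f := by
  obtain ⟨g, hg⟩ := Module.projective_lifting_property p.rangeRestrict (f.codRestrict _ h)
    p.surjective_rangeRestrict
  refine ⟨g, LinearMap.ext fun a => ?_⟩
  exact congrArg Subtype.val (LinearMap.congr_fun hg a)

lemma IsAcyclic.exists_chainMap (hD : IsAcyclic D) (hE : IsAcyclic E)
    (hX : ∀ i : Fin n, Module.Projective R (X i.succ)) (e : X 0 →ₗ[R] Y 0) :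
    ∃ f : ∀ i, X i →ₗ[R] Y i, f 0 = e ∧ ∀ i : Fin n,
      (f i.castSucc).comp (D i) = (E i).comp (f i.succ) := by
  refine Fin.exists_dependent_seq (α := fun i => X i →ₗ[R] Y i)
    -- Sending cycles to cycles is the invariant: by acyclicity it puts `f ∘ D` into the range of
    -- `E`, so that it lifts.
    (fun i f => ∀ x ∈ cycles D i, f x ∈ cycles E i)
    (fun i f g => f.comp (D i) = (E i).comp g) e (fun _ _ => trivial) fun i f hf => ?_
  have := hX i
  obtain ⟨g, hg⟩ := exists_lift_of_forall_mem_range (f.comp (D i)) (E i) (fun a => by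
    rw [hE i]; exact hf _ (hD.map_mem i a))
  refine ⟨g, fun x hx => ?_, hg.symm⟩
  have h1 : D i x = 0 := hx
  have h2 : E i (g x) = f (D i x) := LinearMap.congr_fun hg x
  rw [h1, map_zero] at h2
  exact h2

/-- Acyclicity shows that the range of each component together with the kernel of the differential
is everything, so minimality gives surjectivity; Noetherianity then gives injectivity. The clause on
cycles is carried along to start the next step. -/
lemma IsAcyclic.bijective_of_superfluous (hD : IsAcyclic D)
    (hX : ∀ i : Fin n, IsNoetherian R (X i.succ))
    (hs : ∀ i, IsSuperfluous (LinearMap.ker (D i))) (h : ∀ i, X i →ₗ[R] X i)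
    (h0 : h 0 = LinearMap.id)
    (hc : ∀ i : Fin n, (h i.castSucc).comp (D i) = (D i).comp (h i.succ)) (i : Fin (n + 1)) :
    Function.Bijective (h i) ∧ ∀ x, h i x ∈ cycles D i → x ∈ cycles D i := by
  induction i using Fin.induction with
  | zero => rw [h0]; exact ⟨Function.bijective_id, fun _ _ => trivial⟩
  | succ i ih =>
    have hc' : ∀ x, h i.castSucc (D i x) = D i (h i.succ x) := LinearMap.congr_fun (hc i)
    have hsurj : Function.Surjective (h i.succ) := by
      rw [← LinearMap.range_eq_top]
      apply hs i
      rw [eq_top_iff]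
      rintro x -
      obtain ⟨y, hy⟩ := ih.1.2 (D i x)
      have hy' := ih.2 y (by rw [hy]; exact hD.map_mem i x)
      rw [← hD i] at hy'
      obtain ⟨z, rfl⟩ := hy'
      refine Submodule.mem_sup.2 ⟨x - h i.succ z, ?_, h i.succ z, ⟨z, rfl⟩, sub_add_cancel _ _⟩
      rw [LinearMap.mem_ker, map_sub, ← hc', hy, sub_self]
    have := hX i
    refine ⟨⟨IsNoetherian.injective_of_surjective_endomorphism _ hsurj, hsurj⟩, fun x hx => ?_⟩
    have hx' : D i (h i.succ x) = 0 := hx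
    rw [← hc'] at hx'
    exact ih.1.1 (hx'.trans (map_zero _).symm)

/-- A chain endomorphism over the identity of `X_0` is homotopic to the identity, up to an
endomorphism of the first term with values in the cycles. -/
lemma IsAcyclic.exists_homotopy (hD : IsAcyclic D)
    (hX : ∀ i : Fin n, Module.Projective R (X i.succ)) (c : ∀ i, X i →ₗ[R] X i)
    (h0 : c 0 = LinearMap.id)
    (hc : ∀ i : Fin n, (c i.castSucc).comp (D i) = (D i).comp (c i.succ)) (i : Fin n) :
    ∃ (t : X i.succ →ₗ[R] X i.succ) (s : X i.castSucc →ₗ[R] X i.succ), (D i).comp t = 0 ∧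
      LinearMap.id - t = c i.succ + s.comp (D i) := by
  have key : ∀ (i : Fin n) (t : X i.castSucc →ₗ[R] X i.castSucc) (s : X i.castSucc →ₗ[R] X i.succ),
      (∀ x ∈ cycles D i.castSucc, x = c i.castSucc x + t x) → (D i).comp s = t →
      (D i).comp (LinearMap.id - c i.succ - s.comp (D i)) = 0 := by
    intro i t s ht hs
    refine LinearMap.ext fun x => ?_
    have h1 := ht _ (hD.map_mem i x)
    have h2 : c i.castSucc (D i x) = D i (c i.succ x) := LinearMap.congr_fun (hc i) x
    have h3 : D i (s (D i x)) = t (D i x) := LinearMap.congr_fun hs _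
    simp only [LinearMap.comp_apply, LinearMap.sub_apply, LinearMap.id_apply, map_sub,
      h3, ← h2, LinearMap.zero_apply]
    rw [sub_sub, ← h1, sub_self]
  -- Here `t` is the error left by the homotopy built so far; on cycles it is exactly `1 - c`. The
  -- next homotopy `s` is a lift of `t` along the differential. The final alternative covers `X 0`,
  -- which need not be projective but where `t = 0` lifts trivially.
  have main : ∀ i : Fin (n + 1), ∃ t : X i →ₗ[R] X i, (∀ x, t x ∈ cycles D i) ∧
      (∀ x ∈ cycles D i, x = c i x + t x) ∧ (t = 0 ∨ Module.Projective R (X i)) := by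
    intro i
    induction i using Fin.induction with
    | zero => exact ⟨0, fun _ => trivial, fun x _ => by rw [h0]; simp, Or.inl rfl⟩
    | succ i ih =>
      obtain ⟨t, ht, htc, hp⟩ := ih
      obtain ⟨s, hs⟩ : ∃ s : X i.castSucc →ₗ[R] X i.succ, (D i).comp s = t := by
        rcases hp with rfl | hp
        · exact ⟨0, LinearMap.comp_zero _⟩
        · exact exists_lift_of_forall_mem_range t (D i) fun a => by rw [hD i]; exact ht a
      refine ⟨LinearMap.id - c i.succ - s.comp (D i), LinearMap.congr_fun (key i t s htc hs),
        fun x hx => ?_,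
        Or.inr (hX i)⟩
      have hx' : D i x = 0 := hx
      simp [hx']
  obtain ⟨t, ht, htc, hp⟩ := main i.castSucc
  obtain ⟨s, hs⟩ : ∃ s : X i.castSucc →ₗ[R] X i.succ, (D i).comp s = t := by
    rcases hp with rfl | hp
    · exact ⟨0, LinearMap.comp_zero _⟩
    · exact exists_lift_of_forall_mem_range t (D i) fun a => by rw [hD i]; exact ht a
  exact ⟨_, s, key i t s htc hs, by abel⟩

/-- If `X` is a minimal resolution and `Y` is a resolution without trivial summands concentrated in
the first place, then the cokernels of the maps induced by the first differentials vanish at the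
same time. -/
lemma IsAcyclic.hom_surjective_iff {X Y : Fin (n + 2) → ModuleCat.{v} R}
    {D : ∀ i : Fin (n + 1), X i.succ →ₗ[R] X i.castSucc}
    {E : ∀ i : Fin (n + 1), Y i.succ →ₗ[R] Y i.castSucc} (hD : IsAcyclic D) (hE : IsAcyclic E)
    (hX : ∀ i : Fin (n + 1), Module.Projective R (X i.succ))
    (hY : ∀ i : Fin (n + 1), Module.Projective R (Y i.succ))
    (hX' : ∀ i : Fin (n + 1), IsNoetherian R (X i.succ))
    (hs : ∀ i, IsSuperfluous (LinearMap.ker (D i))) (e : X 0 ≃ₗ[R] Y 0)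
    (ht : ∀ t : Y (Fin.last n).succ →ₗ[R] Y (Fin.last n).succ, (E (Fin.last n)).comp t = 0 →
      Function.Bijective (LinearMap.id - t : Y (Fin.last n).succ →ₗ[R] Y (Fin.last n).succ))
    (M : Type*) [AddCommGroup M] [Module R M] :
    (∀ φ : X (Fin.last n).succ →ₗ[R] M, ∃ ψ : X (Fin.last n).castSucc →ₗ[R] M,
      ψ.comp (D (Fin.last n)) = φ) ↔
    (∀ φ : Y (Fin.last n).succ →ₗ[R] M, ∃ ψ : Y (Fin.last n).castSucc →ₗ[R] M,
      ψ.comp (E (Fin.last n)) = φ) := by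
  obtain ⟨f, hf0, hf⟩ := hD.exists_chainMap hE hX e.toLinearMap
  obtain ⟨g, hg0, hg⟩ := hE.exists_chainMap hD hY e.symm.toLinearMap
  constructor
  · intro h φ
    -- The composite `f g` is the invertible `1 - t` up to a term `s E`. Extending `φ (1 - t)⁻¹ f`
    -- over the minimal resolution and adding `φ (1 - t)⁻¹ s` gives an extension of `φ`.
    obtain ⟨t, s, hts, hst⟩ := hE.exists_homotopy hY (fun i => (f i).comp (g i))
      (LinearMap.ext fun y => by simp [hf0, hg0])
      (fun i => by rw [LinearMap.comp_assoc, hg, ← LinearMap.comp_assoc, hf, LinearMap.comp_assoc])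
      (Fin.last n)
    let b := LinearEquiv.ofBijective _ (ht t hts)
    obtain ⟨ψ, hψ⟩ := h ((φ.comp b.symm.toLinearMap).comp (f (Fin.last n).succ))
    refine ⟨ψ.comp (g (Fin.last n).castSucc) + (φ.comp b.symm.toLinearMap).comp s, ?_⟩
    have h1 : (φ.comp b.symm.toLinearMap).comp (LinearMap.id - t) = φ :=
      LinearMap.ext fun y => congrArg φ (b.symm_apply_apply y)
    refine Eq.trans ?_ h1
    rw [hst, LinearMap.comp_add, LinearMap.add_comp, LinearMap.comp_assoc, hg,
      ← LinearMap.comp_assoc, hψ]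
    rfl
  · intro h φ
    -- On the minimal side `g f` is itself invertible, so no homotopy is needed.
    have hb := (hD.bijective_of_superfluous hX' hs (fun i => (g i).comp (f i))
      (LinearMap.ext fun y => by simp [hf0, hg0])
      (fun i => by rw [LinearMap.comp_assoc, hf, ← LinearMap.comp_assoc, hg, LinearMap.comp_assoc])
      (Fin.last n).succ).1
    let b := LinearEquiv.ofBijective _ hb
    obtain ⟨ψ, hψ⟩ := h ((φ.comp b.symm.toLinearMap).comp (g (Fin.last n).succ))
    refine ⟨ψ.comp (f (Fin.last n).castSucc), ?_⟩
    rw [LinearMap.comp_assoc, hf, ← LinearMap.comp_assoc, hψ]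
    exact LinearMap.ext fun y => congrArg φ (b.symm_apply_apply y)

end Comparison

/-! ### Computing `τ_d`-vanishing from a non-minimal resolution. -/

section MinimalResolution

variable {R : Type v} [Ring R]

/-- The terms of an augmented minimal resolution. -/
def MinimalResolution.augObj {d : ℕ} {M : ModuleCat.{v} R} (P : MinimalResolution (R := R) d M) :
    ℕ → ModuleCat.{v} R
  | 0 => M
  | j + 1 => P.P j

/-- The differentials of an augmented minimal resolution. -/
def MinimalResolution.augMap {d : ℕ} {M : ModuleCat.{v} R} (P : MinimalResolution (R := R) d M) :
    ∀ j : ℕ, P.augObj (j + 1) →ₗ[R] P.augObj j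
  | 0 => P.ε
  | j + 1 => P.δ j

/-- The vanishing of `Hom(M, τ_d N)` in terms of an arbitrary resolution of `N`. -/
lemma homTauVanishes_iff (k : Type w) [Field k] [Algebra k R] [IsNoetherianRing R]
    [IsArtinianRing R] {d : ℕ} (M N : ModuleCat.{v} R) [Module.Finite R N]
    {Y : Fin (d + 3) → ModuleCat.{v} R} {E : ∀ i : Fin (d + 2), Y i.succ →ₗ[R] Y i.castSucc}
    (hE : IsAcyclic E) (hY : ∀ i : Fin (d + 2), Module.Projective R (Y i.succ))
    (e : N ≃ₗ[R] Y 0)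
    (ht : ∀ t : Y (Fin.last (d + 1)).succ →ₗ[R] Y (Fin.last (d + 1)).succ,
      (E (Fin.last (d + 1))).comp t = 0 → Function.Bijective
        (LinearMap.id - t : Y (Fin.last (d + 1)).succ →ₗ[R] Y (Fin.last (d + 1)).succ)) :
    HomTauVanishes k (d + 1) M N ↔
      ∀ φ : Y (Fin.last (d + 1)).succ →ₗ[R] M, ∃ ψ : Y (Fin.last (d + 1)).castSucc →ₗ[R] M,
        ψ.comp (E (Fin.last (d + 1))) = φ := by
  have hne := nonempty_minimalResolution R (d + 1) N
  have h1 : tauD k (d + 1) N =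
      ModuleCat.of R (LinearMap.ker (nakayamaMap k (hne.some.δ d))) := dif_pos hne
  -- The choice made in `tauD` is forgotten: the comparison works for every minimal resolution.
  generalize hne.some = P at h1
  have hfin := P.finite
  have hproj := P.projective
  have := hfin d (Nat.le_succ d)
  have := hfin (d + 1) le_rfl
  have := hproj d (Nat.le_succ d)
  have := hproj (d + 1) le_rfl
  unfold HomTauVanishes
  rw [h1]
  refine (hom_ker_nakayamaMap_vanishes_iff (k := k) (M := M) (P.δ d)).trans ?_
  let X : Fin (d + 3) → ModuleCat.{v} R := fun i => P.augObj i.val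
  let D : ∀ i : Fin (d + 2), X i.succ →ₗ[R] X i.castSucc := fun i => P.augMap i.val
  have hD : IsAcyclic D := by
    intro i
    induction i using Fin.cases with
    | zero => exact LinearMap.range_eq_top.2 P.surjective_ε
    | succ i =>
      obtain ⟨i, hi⟩ := i
      cases i with
      | zero => exact (LinearMap.exact_iff.1 (P.exact_zero (by omega))).symm
      | succ i => exact (LinearMap.exact_iff.1 (P.exact_succ i hi)).symm
  refine IsAcyclic.hom_surjective_iff (X := X) (D := D) hD hE (fun i => hproj _ (by omega)) hY
    (fun i => ?_) (fun i => ?_) e ht M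
  · have := hfin i.val (by omega)
    exact isNoetherian_of_isNoetherianRing_of_finite R (P.P i.val)
  · obtain ⟨i, hi⟩ := i
    cases i with
    | zero => exact P.superfluous_ε
    | succ i => exact P.superfluous_δ i (by omega)

end MinimalResolution

/-! ### The functor `Hom(T, -)` -/

section HomFrom

variable {C : Type u} [Category.{v} C] [Preadditive C] {T : C}

lemma homFrom_map_comp {X Y : C} (φ : (homFrom T).obj X →ₗ[Gam T] (homFrom T).obj Y) (γ : T ⟶ T)
    (g : T ⟶ X) : (φ (γ ≫ g : T ⟶ X) : T ⟶ Y) = γ ≫ (φ g : T ⟶ Y) :=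
  φ.map_smul (MulOpposite.op γ) g

lemma addClosure_homFrom_of_proj {P : ModuleCat.{v} (Gam T)} (hP : proj (Gam T) P) :
    addClosure ((homFrom T).obj T) P := by
  obtain ⟨h1, h2⟩ := hP
  obtain ⟨n, x, x', hx⟩ := exists_dual_basis (Gam T) P
  let a : Gam T →ₗ[Gam T] (homFrom T).obj T :=
    { toFun := fun γ => (γ.unop : T ⟶ T)
      map_add' := fun _ _ => rfl
      map_smul' := fun _ _ => rfl }
  let b : (homFrom T).obj T →ₗ[Gam T] Gam T :=
    { toFun := fun g => MulOpposite.op (g : T ⟶ T)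
      map_add' := fun _ _ => rfl
      map_smul' := fun _ _ => rfl }
  refine addClosure_of_sum (fun l => ModuleCat.ofHom (a.comp (x' l)))
    (fun l => ModuleCat.ofHom ((LinearMap.toSpanSingleton (Gam T) P (x l)).comp b)) ?_
  refine ModuleCat.hom_ext (LinearMap.ext fun p => ?_)
  rw [ModuleCat.hom_sum, LinearMap.sum_apply]
  exact hx p

section

variable [HasFiniteBiproducts C]

/-- Together with `exists_map_eq_of_addClosure`, this makes `Hom(T, -)` fully faithful on morphisms
with source in `add T`; the target is arbitrary. -/
lemma eq_zero_of_addClosure {X Y : C} (hX : addClosure T X) (f : X ⟶ Y)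
    (h : ∀ g : T ⟶ X, g ≫ f = 0) : f = 0 := by
  obtain ⟨n, i, r, e⟩ := exists_sum_of_addClosure hX
  rw [← Category.id_comp f, ← e, Preadditive.sum_comp]
  exact Finset.sum_eq_zero fun j _ => by rw [Category.assoc, h, comp_zero]

lemma exists_map_eq_of_addClosure {X Y : C} (hX : addClosure T X)
    (φ : (homFrom T).obj X →ₗ[Gam T] (homFrom T).obj Y) :
    ∃ f : X ⟶ Y, ((homFrom T).map f).hom = φ := by
  obtain ⟨n, i, r, e⟩ := exists_sum_of_addClosure hX
  refine ⟨∑ j, i j ≫ (φ (r j) : T ⟶ Y), LinearMap.ext fun (g : T ⟶ X) => ?_⟩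
  have h1 : g = ∑ j, (g ≫ i j) ≫ r j := by
    simp only [Category.assoc]
    rw [← Preadditive.comp_sum, e, Category.comp_id]
  have h2 : (φ g : T ⟶ Y) = ∑ j, (g ≫ i j) ≫ (φ (r j) : T ⟶ Y) := by
    conv_lhs => rw [h1]
    refine (map_sum φ (fun j => (g ≫ i j) ≫ r j) Finset.univ).trans ?_
    exact Finset.sum_congr rfl fun j _ => homFrom_map_comp φ _ _
  refine (Preadditive.comp_sum Finset.univ g fun j => i j ≫ (φ (r j) : T ⟶ Y)).trans ?_
  exact (Finset.sum_congr rfl fun j _ => (Category.assoc _ _ _).symm).trans h2.symm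

/-- The module is a retract of `Hom(T, T^n)`. The corresponding idempotent comes from an idempotent
of `T^n`, whose image is the required object. -/
lemma exists_addClosure_homFrom_iso [IsIdempotentComplete C] {P : ModuleCat.{v} (Gam T)}
    (hP : proj (Gam T) P) : ∃ Q : C, addClosure T Q ∧ Nonempty ((homFrom T).obj Q ≅ P) := by
  obtain ⟨n, ⟨ρ⟩⟩ := addClosure_homFrom_of_proj hP
  let B : C := ⨁ fun _ : Fin n => T
  have hB : addClosure T B := ⟨n, ⟨Retract.refl _⟩⟩
  let ρ' : Retract P ((homFrom T).obj B) :=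
    ρ.trans (Retract.ofIso ((homFrom T).mapBiproduct (fun _ : Fin n => T)).symm)
  obtain ⟨ε, hε⟩ := exists_map_eq_of_addClosure hB (ρ'.r ≫ ρ'.i).hom
  replace hε : (homFrom T).map ε = ρ'.r ≫ ρ'.i := ModuleCat.hom_ext hε
  have hidem : ε ≫ ε = ε := by
    rw [← sub_eq_zero]
    refine eq_zero_of_addClosure hB _ fun g => ?_
    have h1 : (homFrom T).map (ε ≫ ε - ε) = 0 := by
      rw [Functor.map_sub, Functor.map_comp, hε]; simp
    exact LinearMap.congr_fun (congrArg ModuleCat.Hom.hom h1) g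
  obtain ⟨Q, i, p, hip, hpi⟩ := IsIdempotentComplete.idempotents_split B ε hidem
  refine ⟨Q, addClosure_of_retract hB ⟨i, p, hip⟩, ⟨⟨(homFrom T).map i ≫ ρ'.r,
    ρ'.i ≫ (homFrom T).map p, ?_, ?_⟩⟩⟩
  · have : ((homFrom T).map i ≫ ρ'.r) ≫ ρ'.i ≫ (homFrom T).map p =
        (homFrom T).map i ≫ (ρ'.r ≫ ρ'.i) ≫ (homFrom T).map p := by simp only [Category.assoc]
    rw [this, ← hε, ← Functor.map_comp, ← Functor.map_comp, ← hpi, Category.assoc, hip,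
      Category.comp_id, hip, CategoryTheory.Functor.map_id]
  · have : (ρ'.i ≫ (homFrom T).map p) ≫ (homFrom T).map i ≫ ρ'.r =
        ρ'.i ≫ (homFrom T).map (p ≫ i) ≫ ρ'.r := by simp only [Category.assoc, Functor.map_comp]
    rw [this, hpi, hε]
    simp

end

section Finiteness

variable (k : Type w) [Field k] [Linear k C]

lemma finite_gam [Module.Finite k (T ⟶ T)] : Module.Finite k (Gam T) :=
  Module.Finite.equiv (MulOpposite.opLinearEquiv k : (T ⟶ T) ≃ₗ[k] (T ⟶ T)ᵐᵒᵖ)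

lemma finite_homFrom (X : C) [Module.Finite k (T ⟶ X)] :
    Module.Finite (Gam T) ((homFrom T).obj X) := by
  have : IsScalarTower k (Gam T) (T ⟶ X) := ⟨fun c γ g => by
    change (c • γ.unop : T ⟶ T) ≫ g = c • ((γ.unop : T ⟶ T) ≫ g)
    exact Linear.smul_comp _ _ _ _ _ _⟩
  exact Module.Finite.of_restrictScalars_finite k (Gam T) (T ⟶ X)

end Finiteness

end HomFrom

/-! ### Vanishing of extensions -/

section Ext

variable {C : Type u} [Category.{v} C] [Preadditive C] [HasFiniteBiproducts C] {Sus : C ≌ C}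

lemma ExtVanishes.of_addClosure_left {X X' Y : C} (h : ExtVanishes Sus X Y)
    (hX : addClosure X X') : ExtVanishes Sus X' Y :=
  fun f => eq_zero_of_addClosure hX f fun _ => h _

lemma ExtVanishes.of_addClosure_right [Sus.functor.Additive] {X Y Y' : C} (h : ExtVanishes Sus X Y)
    (hY : addClosure Y Y') : ExtVanishes Sus X Y' := by
  intro f
  obtain ⟨n, i, r, e⟩ := exists_sum_of_addClosure hY
  rw [← Category.comp_id f, ← CategoryTheory.Functor.map_id, ← e, Functor.map_sum,
    Preadditive.comp_sum]
  refine Finset.sum_eq_zero fun j _ => ?_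
  rw [Functor.map_comp, ← Category.assoc, h (f ≫ Sus.functor.map (i j)), zero_comp]

end Ext

/-! ### Angles with terms in `add T` -/

section ClusterTilting

variable {C : Type u} [Category.{v} C] [Preadditive C] [HasFiniteBiproducts C]
  [HasBinaryBiproducts C] [HasZeroObject C] {Sus : C ≌ C} [Sus.functor.Additive] {d : ℕ}
  {A : Angulation Sus (d + 1)} {T : C} {S : SusSeq Sus (d + 1)}

/-- The map from the second last to the last term. -/
abbrev SusSeq.lastMap (S : SusSeq Sus (d + 1)) : S.obj (Fin.succ 0) ⟶ S.obj 0 := S.map 0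

lemma exists_comp_lastMap (hT : IsRigid Sus T) (hS : A.angle S)
    (hST : ∀ i : Fin (d + 2), addClosure T (S.obj i.succ)) (g : T ⟶ S.obj 0) :
    ∃ l : T ⟶ S.obj (Fin.succ 0), l ≫ S.lastMap = g :=
  have hw : WeakExact S.lastMap S.close := A.weakExact_zero hS
  hw.lift g (hT.of_addClosure_right (hST (Fin.last _)) _)

lemma exists_close_comp (hS : A.angle S) (hST : ∀ i : Fin (d + 2), addClosure T (S.obj i.succ))
    {Z : C} (f : S.obj 0 ⟶ Z) (hf : ∀ g : T ⟶ S.obj 0, g ≫ f = 0) :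
    ∃ l, S.close ≫ l = f :=
  have hw : WeakExact S.lastMap S.close := A.weakExact_zero hS
  hw.desc f (eq_zero_of_addClosure (hST 0) _ fun g => by
    rw [← Category.assoc]; exact hf _)

/-- Such an `f` vanishes on `T_0 ⟶ X`, hence factors through the closing morphism `X ⟶ Σ^d T_d`. -/
lemma exists_factorization_of_homFrom_map_eq_zero (hT : IsClusterTilting A T) {X Z : C} (f : X ⟶ Z)
    (hf : ∀ g : T ⟶ X, g ≫ f = 0) :
    ∃ (W : C) (u : X ⟶ W) (v : W ⟶ Z), addClosure (Sus.functor.obj T) W ∧ u ≫ v = f := by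
  obtain ⟨S, hS, ⟨a⟩, hST⟩ := hT.2 X
  obtain ⟨l, hl⟩ := exists_close_comp hS hST (a.hom ≫ f) fun g => by rw [← Category.assoc, hf]
  refine ⟨_, a.inv ≫ S.close, l, addClosure_map Sus.functor (hST (Fin.last _)), ?_⟩
  rw [Category.assoc, hl, Iso.inv_hom_id_assoc]

lemma homFrom_full (hT : IsClusterTilting A T) : (homFrom T).Full := by
  refine ⟨fun {X Z} φ => ?_⟩
  obtain ⟨S, hS, ⟨a⟩, hST⟩ := hT.2 X
  let ψ : (T ⟶ X) →+ (T ⟶ Z) := φ.hom.toAddMonoidHom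
  obtain ⟨g, hg⟩ := exists_map_eq_of_addClosure (hST 0)
    ((homFrom T).map (S.lastMap ≫ a.hom) ≫ φ).hom
  have hg' : ∀ y : T ⟶ S.obj (Fin.succ 0), y ≫ g = ψ (y ≫ S.lastMap ≫ a.hom) :=
    LinearMap.congr_fun hg
  obtain ⟨p, hw⟩ : ∃ p : S.obj (Fin.succ (Fin.succ 0)) ⟶ S.obj (Fin.succ 0),
      WeakExact p S.lastMap := ⟨_, A.weakExact_map hS 0⟩
  -- The morphism `g` out of `T_0` realizes `φ` on the projective cover term. It kills `T_1`, as may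
  -- be tested on morphisms from `T`, so it descends to the weak cokernel.
  obtain ⟨f, hf⟩ := hw.desc g (eq_zero_of_addClosure (hST _) _ fun y => by
    rw [← Category.assoc, hg', Category.assoc, reassoc_of% hw.zero, zero_comp, comp_zero, map_zero])
  refine ⟨a.inv ≫ f, ModuleCat.hom_ext (LinearMap.ext fun (x : T ⟶ X) => ?_)⟩
  obtain ⟨l, hl⟩ := exists_comp_lastMap hT.1 hS hST (x ≫ a.inv)
  change x ≫ a.inv ≫ f = ψ x
  rw [← Category.assoc, ← hl, Category.assoc, hf, hg', reassoc_of% hl, Iso.inv_hom_id,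
    Category.comp_id]

/-- Exactness inside is that of the angle; surjectivity onto `Hom(T, Y)` uses that `T` is rigid. -/
lemma isAcyclic_homFrom (hT : IsRigid Sus T) (hS : A.angle S)
    (hST : ∀ i : Fin (d + 2), addClosure T (S.obj i.succ)) :
    IsAcyclic (X := fun i => (homFrom T).obj (S.obj i))
      fun i => ((homFrom T).map (S.map i)).hom := by
  intro i
  induction i using Fin.cases with
  | zero => exact LinearMap.range_eq_top.2 (exists_comp_lastMap hT hS hST)
  | succ i =>
    have hw := A.weakExact_map hS i
    apply le_antisymm
    · rintro _ ⟨(y : T ⟶ S.obj i.succ.succ), rfl⟩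
      have h : (y ≫ S.map i.succ) ≫ S.map i.castSucc = 0 := by
        rw [Category.assoc, hw.zero, comp_zero]
      exact h
    · exact fun y hy => hw.lift (y : T ⟶ _) hy

/-- A morphism `x` extends along the first map if and only if `S.close ≫ Sus x = 0`. Since `T` is
rigid, every morphism from the last term to `Sus T` factors through `S.close`. -/
lemma forall_exists_firstMap_comp_iff (hT : IsRigid Sus T) (hS : A.angle S)
    (hST : ∀ i : Fin (d + 2), addClosure T (S.obj i.succ)) (X : C) :
    (∀ x : S.fst ⟶ X, ∃ y, S.firstMap ≫ y = x) ↔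
      ∀ (u : S.obj 0 ⟶ Sus.functor.obj T) (v : Sus.functor.obj T ⟶ Sus.functor.obj X),
          u ≫ v = 0 := by
  constructor
  · intro h u v
    obtain ⟨l, rfl⟩ := exists_close_comp hS hST u fun g => hT _
    obtain ⟨y, hy⟩ := h (Sus.functor.preimage (l ≫ v))
    have h1 := (A.weakExact_close hS).zero
    have h2 : l ≫ v = Sus.functor.map S.firstMap ≫ Sus.functor.map y := by
      rw [← Functor.map_comp, hy, Functor.map_preimage]
    rw [Category.assoc, h2]
    rw [← Category.assoc]
    exact (congrArg (· ≫ Sus.functor.map y) h1).trans zero_comp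
  · intro h x
    obtain ⟨n, i, r, e⟩ := exists_sum_of_addClosure
      (addClosure_map Sus.functor (hST (Fin.last _)))
    have h1 : S.close ≫ Sus.functor.map x = 0 := by
      have h2 : Sus.functor.map x = (∑ j, i j ≫ r j) ≫ Sus.functor.map x := by
        rw [e]; exact (Category.id_comp _).symm
      rw [h2, Preadditive.sum_comp, Preadditive.comp_sum]
      refine Finset.sum_eq_zero fun j _ => ?_
      simpa only [Category.assoc] using h (S.close ≫ i j) (r j ≫ Sus.functor.map x)
    obtain ⟨l, hl⟩ := (A.weakExact_close hS).desc _ h1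
    refine ⟨Sus.functor.preimage l, Sus.functor.map_injective ?_⟩
    rw [Functor.map_comp, Functor.map_preimage, hl]

/-- The resolution of `N` comes from the angle of `Y`. That `Y` is reduced is what makes this
resolution admissible in `homTauVanishes_iff`. -/
lemma homTauVanishes_iff_comp_eq_zero (k : Type w) [Field k] [Linear k C] [IsIdempotentComplete C]
    (hfin : ∀ X Y : C, Module.Finite k (X ⟶ Y)) (hT : IsClusterTilting A T) {X Y : C}
    (hY : IsReduced (Sus.functor.obj T) Y) {M N : ModuleCat.{v} (Gam T)}
    (eM : (homFrom T).obj X ≅ M) (eN : (homFrom T).obj Y ≅ N) :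
    HomTauVanishes k (d + 1) M N ↔
      ∀ (u : Y ⟶ Sus.functor.obj T) (v : Sus.functor.obj T ⟶ Sus.functor.obj X), u ≫ v = 0 := by
  obtain ⟨S, hS, ⟨a⟩, hST⟩ := hT.2 Y
  have := hfin T T
  have := hfin T Y
  have := finite_gam (T := T) k
  have := finite_homFrom (T := T) k Y
  have : IsArtinianRing (Gam T) := IsArtinianRing.of_finite k _
  have : Module.Finite (Gam T) N := Module.Finite.equiv eN.toLinearEquiv
  have hproj : ∀ i : Fin (d + 2), Module.Projective (Gam T) ((homFrom T).obj (S.obj i.succ)) :=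
    fun i => (proj_homFrom (hST i)).2
  have hW := addClosure_map Sus.functor (hST (Fin.last _))
  have := hfin (Sus.functor.obj S.fst) (Sus.functor.obj S.fst)
  have hrad : RadPair (Sus.functor.obj S.fst) (S.obj 0) :=
    (hY.radPair k hW).of_addClosure (addClosure_of_iso (addClosure_self Y) a.symm)
  refine (homTauVanishes_iff k M N (isAcyclic_homFrom hT.1 hS hST) hproj
    (eN.symm ≪≫ (homFrom T).mapIso a.symm).toLinearEquiv fun t ht => ?_).trans ?_
  · obtain ⟨t', rfl⟩ := exists_map_eq_of_addClosure (hST (Fin.last _)) t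
    have h1 : t' ≫ S.firstMap = 0 := eq_zero_of_addClosure (hST (Fin.last _)) _ fun g => by
      rw [← Category.assoc]
      exact LinearMap.congr_fun ht g
    -- The suspension of `t'` factors through `Y` and is an endomorphism of an object of `add (Sus
    -- T)`, so it is radical and `1 - t'` is invertible.
    obtain ⟨h, hh⟩ := (A.weakExact_close hS).lift (Sus.functor.map t') (by
      refine (Functor.map_comp _ _ _).symm.trans ?_
      rw [h1, Functor.map_zero])
    let c : S.obj 0 ⟶ Sus.functor.obj S.fst := S.close
    have h2 := hrad h c
    have h3 : 𝟙 (Sus.functor.obj S.fst) - h ≫ c = Sus.functor.map (𝟙 S.fst - t') := by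
      rw [Functor.map_sub, CategoryTheory.Functor.map_id]
      exact congrArg _ hh
    rw [h3] at h2
    have h4 := isIso_of_reflects_iso (𝟙 S.fst - t') Sus.functor
    have h5 := ((asIso ((homFrom T).map (𝟙 S.fst - t'))).toLinearEquiv).bijective
    have h6 : (LinearMap.id - ((homFrom T).map t').hom :
        (homFrom T).obj S.fst →ₗ[Gam T] (homFrom T).obj S.fst) =
        ((homFrom T).map (𝟙 S.fst - t')).hom := by
      rw [Functor.map_sub, CategoryTheory.Functor.map_id]
      rfl
    exact h6 ▸ h5
  · have h1 : ∀ Z : C, addClosure T Z → ∀ φ : (homFrom T).obj Z →ₗ[Gam T] M, ∃ x : Z ⟶ X,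
        φ = ((homFrom T).map x ≫ eM.hom).hom := fun Z hZ φ => by
      obtain ⟨x, hx⟩ := exists_map_eq_of_addClosure hZ (ModuleCat.ofHom φ ≫ eM.inv).hom
      refine ⟨x, ?_⟩
      have : (homFrom T).map x = ModuleCat.ofHom φ ≫ eM.inv := ModuleCat.hom_ext hx
      rw [this]
      simp
    refine Iff.trans ?_ ((forall_exists_firstMap_comp_iff hT.1 hS hST X).trans ?_)
    · constructor
      · intro h x
        obtain ⟨ψ, hψ⟩ := h ((homFrom T).map x ≫ eM.hom).hom
        obtain ⟨y, rfl⟩ := h1 S.snd (hST (Fin.last d).castSucc) ψ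
        refine ⟨y, ?_⟩
        have h2 : (homFrom T).map (S.firstMap ≫ y) ≫ eM.hom = (homFrom T).map x ≫ eM.hom := by
          rw [Functor.map_comp]
          exact ModuleCat.hom_ext hψ
        rw [cancel_mono] at h2
        rw [← sub_eq_zero]
        refine eq_zero_of_addClosure (hST (Fin.last _)) _ fun g => ?_
        rw [Preadditive.comp_sub, sub_eq_zero]
        exact LinearMap.congr_fun (congrArg ModuleCat.Hom.hom h2) g
      · intro h φ
        obtain ⟨x, rfl⟩ := h1 _ (hST _) φ
        obtain ⟨y, rfl⟩ := h x
        refine ⟨((homFrom T).map y ≫ eM.hom).hom, ?_⟩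
        rw [Functor.map_comp]
        rfl
    · constructor
      · intro h u v
        rw [← cancel_epi a.hom, ← Category.assoc, h, comp_zero]
      · intro h u v
        rw [← cancel_epi a.inv, ← Category.assoc, h, comp_zero]

end ClusterTilting

/-! ### The Calabi-Yau property -/

section CalabiYau

variable {C : Type u} [Category.{v} C] [Preadditive C] {k : Type w} [Field k] [Linear k C]
  {Sus : C ≌ C} [Sus.functor.Additive]

/-- By duality `Hom(Y, Sus X)` is dual to `Hom(Sus X, Sus (Sus Y))`, which is `Hom(X, Sus Y)` up to
suspension. -/
lemma IsCalabiYau.extVanishes_symm (hCY : IsCalabiYau k Sus) {X Y : C} (h : ExtVanishes Sus X Y) :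
    ExtVanishes Sus Y X := by
  obtain ⟨e, -⟩ := hCY
  intro f
  rw [← (e Y (Sus.functor.obj X)).map_eq_zero_iff]
  refine LinearMap.ext fun y => ?_
  rw [← Sus.functor.map_preimage y, h (Sus.functor.preimage y), Functor.map_zero, map_zero]
  rfl

lemma IsCalabiYau.extVanishes_comm (hCY : IsCalabiYau k Sus) (X Y : C) :
    ExtVanishes Sus X Y ↔ ExtVanishes Sus Y X :=
  ⟨hCY.extVanishes_symm, hCY.extVanishes_symm⟩

/-- `Ext(X, Y)` vanishes if and only if the morphisms `X ⟶ Sus Y` and `Y ⟶ Sus X` that factor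
through `Sus T` vanish. -/
lemma IsCalabiYau.extVanishes_iff [HasFiniteBiproducts C] [HasBinaryBiproducts C] [HasZeroObject C]
    (hCY : IsCalabiYau k Sus) {d : ℕ} {A : Angulation Sus (d + 1)} {T : C}
    (hT : IsClusterTilting A T) (X Y : C) :
    ExtVanishes Sus X Y ↔
      (∀ (u : Y ⟶ Sus.functor.obj T) (v : Sus.functor.obj T ⟶ Sus.functor.obj X), u ≫ v = 0) ∧
      (∀ (u : X ⟶ Sus.functor.obj T) (v : Sus.functor.obj T ⟶ Sus.functor.obj Y), u ≫ v = 0) := by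
  refine ⟨fun h => ⟨fun _ _ => hCY.extVanishes_symm h _, fun _ _ => h _⟩, fun ⟨h1, h2⟩ f => ?_⟩
  obtain ⟨e, he⟩ := hCY
  -- By naturality of the duality, the form of `g ≫ f` at `y` is that of `f` at `y` followed by the
  -- double suspension of `g`. The latter is the suspension of a composite `Y ⟶ Sus T ⟶ Sus X`,
  -- which vanishes. So `f` is killed by `Hom(T, -)` and factors through `add (Sus T)`.
  obtain ⟨W, u, v, hW, rfl⟩ := exists_factorization_of_homFrom_map_eq_zero hT f fun g => by
    rw [← (e T (Sus.functor.obj Y)).map_eq_zero_iff]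
    refine LinearMap.ext fun y => ?_
    have h3 := he g (𝟙 _) f y
    rw [Category.comp_id, Category.id_comp, ← Sus.functor.map_preimage y, ← Functor.map_comp, h1,
      Functor.map_zero, map_zero] at h3
    rw [← Sus.functor.map_preimage y]
    exact h3
  obtain ⟨n, i, r, e'⟩ := exists_sum_of_addClosure hW
  rw [← Category.id_comp v, ← e', Preadditive.sum_comp, Preadditive.comp_sum]
  refine Finset.sum_eq_zero fun j _ => ?_
  simpa only [Category.assoc] using h2 (u ≫ i j) (r j ≫ v)

end CalabiYau

/-! ### Isomorphisms and direct sums in `add` and `Ext`. -/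

section Biprod

variable {C : Type u} [Category.{v} C] [Preadditive C] [HasFiniteBiproducts C]

lemma addClosure_iff_of_iso_left {U V X : C} (e : U ≅ V) : addClosure U X ↔ addClosure V X :=
  ⟨addClosure_trans (addClosure_of_iso (addClosure_self V) e.symm),
    addClosure_trans (addClosure_of_iso (addClosure_self U) e)⟩

lemma addClosure_iff_of_iso_right {U X Y : C} (e : X ≅ Y) : addClosure U X ↔ addClosure U Y :=
  ⟨fun h => addClosure_of_iso h e, fun h => addClosure_of_iso h e.symm⟩

lemma extVanishes_iff_of_iso_left {Sus : C ≌ C} {X Y Z : C} (e : X ≅ Y) :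
    ExtVanishes Sus X Z ↔ ExtVanishes Sus Y Z :=
  ⟨fun h => h.of_addClosure_left (addClosure_of_iso (addClosure_self X) e),
    fun h => h.of_addClosure_left (addClosure_of_iso (addClosure_self Y) e.symm)⟩

lemma extVanishes_iff_of_iso_right {Sus : C ≌ C} [Sus.functor.Additive] {X Y Z : C} (e : X ≅ Y) :
    ExtVanishes Sus Z X ↔ ExtVanishes Sus Z Y :=
  ⟨fun h => h.of_addClosure_right (addClosure_of_iso (addClosure_self X) e),
    fun h => h.of_addClosure_right (addClosure_of_iso (addClosure_self Y) e.symm)⟩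

/-- Lifting the decomposition of the identity gives an endomorphism over the identity. Faithfulness
is not needed: this endomorphism only has to be invertible, as its inverse can be absorbed. -/
lemma addClosure_of_map {D : Type*} [Category D] [Preadditive D] [HasFiniteBiproducts D] (G : C ⥤ D)
    [G.Additive] {U Y : C} (h1 : ∀ φ : G.obj U ⟶ G.obj Y, ∃ f, G.map f = φ)
    (h2 : ∀ φ : G.obj Y ⟶ G.obj U, ∃ f, G.map f = φ)
    (h3 : ∀ f : Y ⟶ Y, G.map f = 𝟙 _ → IsIso f) (h : addClosure (G.obj U) (G.obj Y)) :
    addClosure U Y := by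
  obtain ⟨n, i, r, e⟩ := exists_sum_of_addClosure h
  choose i' hi using fun j => h2 (i j)
  choose r' hr using fun j => h1 (r j)
  have h4 := h3 (∑ j, i' j ≫ r' j) (by
    rw [Functor.map_sum, ← e]
    exact Finset.sum_congr rfl fun j _ => by rw [Functor.map_comp, hi, hr])
  refine addClosure_of_sum i' (fun j => r' j ≫ inv (∑ j, i' j ≫ r' j)) ?_
  have h5 := IsIso.hom_inv_id (∑ j, i' j ≫ r' j)
  rw [Preadditive.sum_comp] at h5
  simpa only [Category.assoc] using h5

variable [HasBinaryBiproducts C]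

/-- The first summand of a direct sum. -/
def retractBiprodLeft (X Y : C) : Retract X (X ⊞ Y) := ⟨biprod.inl, biprod.fst, by simp⟩

/-- The second summand of a direct sum. -/
def retractBiprodRight (X Y : C) : Retract Y (X ⊞ Y) := ⟨biprod.inr, biprod.snd, by simp⟩

lemma addClosure_biprod_iff {U X Y : C} :
    addClosure U (X ⊞ Y) ↔ addClosure U X ∧ addClosure U Y :=
  ⟨fun h => ⟨addClosure_of_retract h (retractBiprodLeft X Y),
    addClosure_of_retract h (retractBiprodRight X Y)⟩, fun h => addClosure_biprod h.1 h.2⟩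

lemma extVanishes_biprod_left_iff {Sus : C ≌ C} {X Y Z : C} :
    ExtVanishes Sus (X ⊞ Y) Z ↔ ExtVanishes Sus X Z ∧ ExtVanishes Sus Y Z := by
  refine ⟨fun h => ?_, fun h f => biprod.hom_ext' _ _ ?_ ?_⟩
  · obtain ⟨h1, h2⟩ := addClosure_biprod_iff.1 (addClosure_self (X ⊞ Y))
    exact ⟨h.of_addClosure_left h1, h.of_addClosure_left h2⟩
  · rw [h.1 (biprod.inl ≫ f), comp_zero]
  · rw [h.2 (biprod.inr ≫ f), comp_zero]

end Biprod

/-! ### Recovering objects from their modules. -/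

section Reduced

variable {C : Type u} [Category.{v} C] [Preadditive C] [HasFiniteBiproducts C] {T : C}

lemma homFrom_map_eq_of_addClosure {X Y : C} (hX : addClosure T X) {f g : X ⟶ Y}
    (h : (homFrom T).map f = (homFrom T).map g) : f = g := by
  rw [← sub_eq_zero]
  refine eq_zero_of_addClosure hX _ fun x => ?_
  rw [Preadditive.comp_sub, sub_eq_zero]
  exact LinearMap.congr_fun (congrArg ModuleCat.Hom.hom h) x

lemma exists_homFrom_map_eq_of_addClosure {X Y : C} (hX : addClosure T X)
    (φ : (homFrom T).obj X ⟶ (homFrom T).obj Y) : ∃ f, (homFrom T).map f = φ := by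
  obtain ⟨f, hf⟩ := exists_map_eq_of_addClosure hX φ.hom
  exact ⟨f, ModuleCat.hom_ext hf⟩

lemma nonempty_iso_of_homFrom_iso_of_addClosure {X Y : C} (hX : addClosure T X)
    (hY : addClosure T Y) (e : (homFrom T).obj X ≅ (homFrom T).obj Y) : Nonempty (X ≅ Y) := by
  obtain ⟨f, hf⟩ := exists_homFrom_map_eq_of_addClosure hX e.hom
  obtain ⟨g, hg⟩ := exists_homFrom_map_eq_of_addClosure hY e.inv
  exact ⟨⟨f, g, homFrom_map_eq_of_addClosure hX (by
      rw [Functor.map_comp, hf, hg, e.hom_inv_id, CategoryTheory.Functor.map_id]),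
    homFrom_map_eq_of_addClosure hY (by
      rw [Functor.map_comp, hf, hg, e.inv_hom_id, CategoryTheory.Functor.map_id])⟩⟩

lemma eq_zero_of_rigid {Sus : C ≌ C} (hT : IsRigid Sus T) {X : C}
    (hX : addClosure (Sus.functor.obj T) X)
    (g : T ⟶ X) : g = 0 := by
  obtain ⟨n, i, r, e⟩ := exists_sum_of_addClosure hX
  rw [← Category.comp_id g, ← e, Preadditive.comp_sum]
  exact Finset.sum_eq_zero fun j _ => by rw [← Category.assoc, hT (g ≫ i j), zero_comp]

variable [HasBinaryBiproducts C] {k : Type w} [Field k] [Linear k C] [IsIdempotentComplete C]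

/-- Decompositions with second summand `Sus Q`, where `Q` is in `add T`. -/
lemma exists_reduced_decomposition (hfin : ∀ X Y : C, Module.Finite k (X ⟶ Y)) (Sus : C ≌ C)
    [Sus.functor.Additive] (T X : C) : ∃ X' Q : C, Nonempty (X ≅ X' ⊞ Sus.functor.obj Q) ∧
      IsReduced (Sus.functor.obj T) X' ∧ addClosure T Q := by
  obtain ⟨X', X'', ⟨e⟩, h1, h2⟩ :=
    exists_biprod_isReduced k (fun X => hfin X X) (Sus.functor.obj T) X
  exact ⟨X', Sus.inverse.obj X'', ⟨e ≪≫ biprod.mapIso (Iso.refl _) (Sus.counitIso.app X'').symm⟩,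
    h1, addClosure_inverse h2⟩

variable {Sus : C ≌ C} [Sus.functor.Additive]

/-- Discarding the summand in `add (Sus T)` does not change the module, since `Hom(T, -)` kills it.
-/
lemma exists_reduced_homFrom_iso (hfin : ∀ X Y : C, Module.Finite k (X ⟶ Y)) (hT : IsRigid Sus T)
    {M : ModuleCat.{v} (Gam T)} (hM : imageD T M) :
    ∃ X : C, IsReduced (Sus.functor.obj T) X ∧ Nonempty ((homFrom T).obj X ≅ M) := by
  obtain ⟨Z, ⟨e⟩⟩ := hM
  obtain ⟨X, Q, ⟨a⟩, hX, hQ⟩ := exists_reduced_decomposition hfin Sus T Z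
  have h1 : (homFrom T).map (biprod.snd : X ⊞ Sus.functor.obj Q ⟶ _) = 0 :=
    ModuleCat.hom_ext (LinearMap.ext fun g =>
      eq_zero_of_rigid hT (addClosure_map Sus.functor hQ) _)
  refine ⟨X, hX, ⟨⟨(homFrom T).map biprod.inl, (homFrom T).map biprod.fst, ?_, ?_⟩ ≪≫
    (homFrom T).mapIso a.symm ≪≫ e⟩⟩
  · rw [← Functor.map_comp, biprod.inl_fst, CategoryTheory.Functor.map_id]
  · have h2 := congrArg (homFrom T).map (biprod.total (X := X) (Y := Sus.functor.obj Q))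
    rw [Functor.map_add, Functor.map_comp, Functor.map_comp, h1, zero_comp, add_zero,
      CategoryTheory.Functor.map_id] at h2
    exact h2

variable [HasZeroObject C] {d : ℕ} {A : Angulation Sus (d + 1)}

/-- The difference `1 - f` factors through `add (Sus T)`, hence is radical on a reduced object. -/
lemma isIso_of_homFrom_map_eq_id (hfin : ∀ X Y : C, Module.Finite k (X ⟶ Y))
    (hT : IsClusterTilting A T) {X : C} (hX : IsReduced (Sus.functor.obj T) X)
    (f : X ⟶ X) (hf : (homFrom T).map f = 𝟙 _) : IsIso f := by
  obtain ⟨W, u, v, hW, h⟩ := exists_factorization_of_homFrom_map_eq_zero hT (𝟙 X - f) fun g => by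
    rw [Preadditive.comp_sub, sub_eq_zero, Category.comp_id]
    exact (LinearMap.congr_fun (congrArg ModuleCat.Hom.hom hf) g).symm
  have := hfin W W
  have h1 := (hX.radPair k hW).symm u v
  rwa [h, sub_sub_cancel] at h1

lemma nonempty_iso_of_homFrom_iso (hfin : ∀ X Y : C, Module.Finite k (X ⟶ Y))
    (hT : IsClusterTilting A T) {X Y : C} (hX : IsReduced (Sus.functor.obj T) X)
    (hY : IsReduced (Sus.functor.obj T) Y)
    (e : (homFrom T).obj X ≅ (homFrom T).obj Y) : Nonempty (X ≅ Y) := by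
  have := homFrom_full hT
  have h1 := isIso_of_homFrom_map_eq_id hfin hT hX
    ((homFrom T).preimage e.hom ≫ (homFrom T).preimage e.inv) (by
      rw [Functor.map_comp, Functor.map_preimage, Functor.map_preimage, e.hom_inv_id])
  have h2 := isIso_of_homFrom_map_eq_id hfin hT hY
    ((homFrom T).preimage e.inv ≫ (homFrom T).preimage e.hom) (by
      rw [Functor.map_comp, Functor.map_preimage, Functor.map_preimage, e.inv_hom_id])
  have := isIso_of_isIso_comp_comp _ _ h1 h2
  exact ⟨asIso ((homFrom T).preimage e.hom)⟩

end Reduced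

/-! ### Objects and pairs -/

section Correspondence

variable {C : Type u} [Category.{v} C] [Preadditive C] [HasFiniteBiproducts C]
  [HasBinaryBiproducts C] {T : C} {Sus : C ≌ C}

/-- `X` corresponds to the pair `p` of modules. -/
def Corresponds (Sus : C ≌ C) (X : C)
    (p : (imageD T).FullSubcategory × (proj (Gam T)).FullSubcategory) : Prop :=
  ∃ X' Q : C, Nonempty (X ≅ X' ⊞ Sus.functor.obj Q) ∧ IsReduced (Sus.functor.obj T) X' ∧
    addClosure T Q ∧ Nonempty ((homFrom T).obj X' ≅ p.1.obj) ∧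
      Nonempty ((homFrom T).obj Q ≅ p.2.obj)

lemma Corresponds.congr {X Y : C}
    {p q : (imageD T).FullSubcategory × (proj (Gam T)).FullSubcategory} (h : Corresponds Sus X p)
    (hXY : Nonempty (X ≅ Y)) (h1 : Nonempty (p.1 ≅ q.1)) (h2 : Nonempty (p.2 ≅ q.2)) :
    Corresponds Sus Y q := by
  obtain ⟨X', Q, ⟨e⟩, hX, hQ, ⟨a⟩, ⟨b⟩⟩ := h
  obtain ⟨e'⟩ := hXY
  obtain ⟨a'⟩ := h1
  obtain ⟨b'⟩ := h2
  exact ⟨X', Q, ⟨e'.symm ≪≫ e⟩, hX, hQ, ⟨a ≪≫ (ObjectProperty.ι _).mapIso a'⟩,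
    ⟨b ≪≫ (ObjectProperty.ι _).mapIso b'⟩⟩

variable [Sus.functor.Additive]

lemma Decomposition.corresponds {X : C} (c : Decomposition Sus T X) : Corresponds Sus X c.Δ :=
  ⟨c.X', Sus.inverse.obj c.X'',
    ⟨c.iso ≪≫ biprod.mapIso (Iso.refl _) (Sus.counitIso.app c.X'').symm⟩, c.isZero_of_summand,
    addClosure_inverse c.mem_add, ⟨Iso.refl _⟩, ⟨Iso.refl _⟩⟩

variable {k : Type w} [Field k] [Linear k C] [IsIdempotentComplete C]

/-- The two kinds of summands form a `RadPair`, so each can be cancelled; the braiding exchanges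
their roles. -/
lemma Corresponds.nonempty_iso_pair (hfin : ∀ X Y : C, Module.Finite k (X ⟶ Y)) {X : C}
    {p q : (imageD T).FullSubcategory × (proj (Gam T)).FullSubcategory} (h : Corresponds Sus X p)
    (h' : Corresponds Sus X q) : Nonempty (p.1 ≅ q.1) ∧ Nonempty (p.2 ≅ q.2) := by
  obtain ⟨X', Q, ⟨e⟩, hX, hQ, ⟨a⟩, ⟨b⟩⟩ := h
  obtain ⟨Y', Q', ⟨e'⟩, hY, hQ', ⟨a'⟩, ⟨b'⟩⟩ := h'
  have hrad : ∀ {X Q : C}, IsReduced (Sus.functor.obj T) X → addClosure T Q →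
      RadPair (Sus.functor.obj Q) X := fun {_ Q} hX hQ =>
    have := hfin (Sus.functor.obj Q) (Sus.functor.obj Q)
    hX.radPair k (addClosure_map Sus.functor hQ)
  obtain ⟨f⟩ := nonempty_iso_of_biprod_iso (e.symm ≪≫ e') (hrad hY hQ) (hrad hX hQ')
  obtain ⟨g⟩ := nonempty_iso_of_biprod_iso (biprod.braiding _ _ ≪≫ e.symm ≪≫ e' ≪≫
    biprod.braiding _ _) (hrad hX hQ').symm (hrad hY hQ).symm
  exact ⟨⟨ObjectProperty.isoMk _ (a.symm ≪≫ (homFrom T).mapIso g ≪≫ a')⟩,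
    ⟨ObjectProperty.isoMk _ (b.symm ≪≫ (homFrom T).mapIso (Sus.functor.preimageIso f) ≪≫ b')⟩⟩

lemma exists_corresponds (hfin : ∀ X Y : C, Module.Finite k (X ⟶ Y)) (hT : IsRigid Sus T)
    (p : (imageD T).FullSubcategory × (proj (Gam T)).FullSubcategory) :
    ∃ X, Corresponds Sus X p := by
  obtain ⟨X', hX, e⟩ := exists_reduced_homFrom_iso hfin hT p.1.property
  obtain ⟨Q, hQ, e'⟩ := exists_addClosure_homFrom_iso p.2.property
  exact ⟨_, X', Q, ⟨Iso.refl _⟩, hX, hQ, e, e'⟩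

variable [HasZeroObject C] {d : ℕ} {A : Angulation Sus (d + 1)}

lemma Corresponds.nonempty_iso (hfin : ∀ X Y : C, Module.Finite k (X ⟶ Y))
    (hT : IsClusterTilting A T) {X Y : C}
    {p : (imageD T).FullSubcategory × (proj (Gam T)).FullSubcategory} (h : Corresponds Sus X p)
    (h' : Corresponds Sus Y p) : Nonempty (X ≅ Y) := by
  obtain ⟨X', Q, ⟨e⟩, hX, hQ, ⟨a⟩, ⟨b⟩⟩ := h
  obtain ⟨Y', Q', ⟨e'⟩, hY, hQ', ⟨a'⟩, ⟨b'⟩⟩ := h'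
  obtain ⟨f⟩ := nonempty_iso_of_homFrom_iso hfin hT hX hY (a ≪≫ a'.symm)
  obtain ⟨g⟩ := nonempty_iso_of_homFrom_iso_of_addClosure hQ hQ' (b ≪≫ b'.symm)
  exact ⟨e ≪≫ biprod.mapIso f (Sus.functor.mapIso g) ≪≫ e'.symm⟩

end Correspondence

/-! ### Rigid and self-perpendicular objects -/

section Rigid

/-- This turns the condition `Hom(P, M) = 0` on a pair into a vanishing of `Ext` with the summand
`Sus Q`. -/
lemma forall_hom_eq_zero_iff_extVanishes {C : Type u} [Category.{v} C] [Preadditive C] {Sus : C ≌ C}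
    [Sus.functor.Additive] {Q X : C} :
    (∀ f : Q ⟶ X, f = 0) ↔ ExtVanishes Sus (Sus.functor.obj Q) X := by
  refine ⟨fun h f => ?_, fun h f => Sus.functor.map_injective ?_⟩
  · rw [← Sus.functor.map_preimage f, h (Sus.functor.preimage f), Functor.map_zero]
  · rw [Functor.map_zero, h (Sus.functor.map f)]

variable {C : Type u} [Category.{v} C] [Preadditive C] [HasFiniteBiproducts C] {T : C}
  {Sus : C ≌ C}

lemma homVanishes_iff {X Y : C} (hX : addClosure T X) {M N : ModuleCat.{v} (Gam T)}
    (eM : (homFrom T).obj X ≅ M) (eN : (homFrom T).obj Y ≅ N) :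
    HomVanishes M N ↔ ∀ f : X ⟶ Y, f = 0 := by
  constructor
  · intro h f
    refine homFrom_map_eq_of_addClosure hX ?_
    rw [Functor.map_zero, ← cancel_epi eM.inv, ← cancel_mono eN.hom, comp_zero, zero_comp]
    exact ModuleCat.hom_ext (h _)
  · intro h φ
    obtain ⟨f, hf⟩ := exists_homFrom_map_eq_of_addClosure hX (eM.hom ≫ ModuleCat.ofHom φ ≫ eN.inv)
    rw [h f, Functor.map_zero] at hf
    have h1 : ModuleCat.ofHom φ = 0 := by
      rw [← cancel_epi eM.hom, ← cancel_mono eN.inv, Category.assoc, ← hf, comp_zero, zero_comp]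
    exact congrArg ModuleCat.Hom.hom h1

lemma IsRigid.extVanishes_map [Sus.functor.Additive] (hT : IsRigid Sus T) {Q Q' : C}
    (hQ : addClosure T Q) (hQ' : addClosure T Q') :
    ExtVanishes Sus (Sus.functor.obj Q) (Sus.functor.obj Q') :=
  forall_hom_eq_zero_iff_extVanishes.1 ((hT.of_addClosure_left hQ).of_addClosure_right hQ')

variable [HasBinaryBiproducts C] {k : Type w} [Field k] [Linear k C]
  [Sus.functor.Additive]

lemma IsCalabiYau.extVanishes_biprod_right_iff (hCY : IsCalabiYau k Sus) {X Y Z : C} :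
    ExtVanishes Sus Z (X ⊞ Y) ↔ ExtVanishes Sus Z X ∧ ExtVanishes Sus Z Y := by
  rw [hCY.extVanishes_comm, extVanishes_biprod_left_iff, hCY.extVanishes_comm X,
    hCY.extVanishes_comm Y]

variable [IsIdempotentComplete C]

/-- The objects of `add X` in `add (Sus T)`. -/
lemma addClosure_homFrom_iff_of_addClosure (hfin : ∀ X Y : C, Module.Finite k (X ⟶ Y))
    {X' Q Q' : C} (hX : IsReduced (Sus.functor.obj T) X') (hQ : addClosure T Q)
    (hQ' : addClosure T Q') :
    addClosure ((homFrom T).obj Q) ((homFrom T).obj Q') ↔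
      addClosure (X' ⊞ Sus.functor.obj Q) (Sus.functor.obj Q') := by
  have := hfin (Sus.functor.obj Q') (Sus.functor.obj Q')
  constructor
  · intro h
    have h1 := addClosure_of_map (homFrom T) (exists_homFrom_map_eq_of_addClosure hQ)
      (exists_homFrom_map_eq_of_addClosure hQ') (fun f hf => by
        rw [homFrom_map_eq_of_addClosure hQ' (hf.trans (CategoryTheory.Functor.map_id _ _).symm)]
        infer_instance) h
    exact addClosure_trans (addClosure_biprod_iff.1 (addClosure_self _)).2
      (addClosure_map Sus.functor h1)
  · intro h
    have h1 := addClosure_of_addClosure_biprod (hX.radPair k (addClosure_map Sus.functor hQ')) h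
    refine addClosure_map (homFrom T) (addClosure_of_map Sus.functor
      (fun φ => ⟨_, Sus.functor.map_preimage φ⟩) (fun φ => ⟨_, Sus.functor.map_preimage φ⟩)
      (fun f hf => ?_) h1)
    rw [Sus.functor.map_injective (hf.trans (CategoryTheory.Functor.map_id _ _).symm)]
    infer_instance

variable [HasZeroObject C] {d : ℕ} {A : Angulation Sus (d + 1)}

/-- The vanishing of `Ext(X, Y)` in terms of modules, for objects without summands in
`add (Sus T)`. -/
lemma extVanishes_iff_homTauVanishes (hfin : ∀ X Y : C, Module.Finite k (X ⟶ Y))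
    (hCY : IsCalabiYau k Sus) (hT : IsClusterTilting A T) {X Y : C}
    (hX : IsReduced (Sus.functor.obj T) X) (hY : IsReduced (Sus.functor.obj T) Y)
    {M N : ModuleCat.{v} (Gam T)} (eM : (homFrom T).obj X ≅ M) (eN : (homFrom T).obj Y ≅ N) :
    ExtVanishes Sus X Y ↔ HomTauVanishes k (d + 1) M N ∧ HomTauVanishes k (d + 1) N M := by
  rw [hCY.extVanishes_iff hT, homTauVanishes_iff_comp_eq_zero k hfin hT hY eM eN,
    homTauVanishes_iff_comp_eq_zero k hfin hT hX eN eM]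

/-- Of the four blocks of `Ext(X, X)` for `X ≅ X' ⊞ Sus Q`, the one on `X'` gives the
`τ_d`-condition, the two mixed ones are equivalent and give `Hom(P, M) = 0`, and the last vanishes
as `T` is rigid. -/
lemma Corresponds.isRigid_iff (hfin : ∀ X Y : C, Module.Finite k (X ⟶ Y))
    (hCY : IsCalabiYau k Sus) (hT : IsClusterTilting A T) {X : C}
    {p : (imageD T).FullSubcategory × (proj (Gam T)).FullSubcategory} (h : Corresponds Sus X p) :
    IsRigid Sus X ↔ IsTauRigidPair k (d + 1) p := by
  obtain ⟨X', Q, ⟨e⟩, hX, hQ, ⟨a⟩, ⟨b⟩⟩ := h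
  have h1 := extVanishes_iff_homTauVanishes hfin hCY hT hX hX a a
  have h2 := homVanishes_iff hQ b a
  unfold IsRigid IsTauRigidPair
  rw [extVanishes_iff_of_iso_left e, extVanishes_iff_of_iso_right e, extVanishes_biprod_left_iff,
    hCY.extVanishes_biprod_right_iff, hCY.extVanishes_biprod_right_iff, h2,
    forall_hom_eq_zero_iff_extVanishes (Sus := Sus), hCY.extVanishes_comm X' (Sus.functor.obj Q),
      h1]
  have h3 := hT.1.extVanishes_map hQ hQ
  tauto

/-- The objects of `add X` without summands in `add (Sus T)`. -/
lemma addClosure_homFrom_iff_of_isReduced (hfin : ∀ X Y : C, Module.Finite k (X ⟶ Y))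
    (hT : IsClusterTilting A T) {X' Q Y : C} (hQ : addClosure T Q)
    (hY : IsReduced (Sus.functor.obj T) Y) :
    addClosure ((homFrom T).obj X') ((homFrom T).obj Y) ↔
      addClosure (X' ⊞ Sus.functor.obj Q) Y := by
  have := homFrom_full hT
  have := hfin (Sus.functor.obj Q) (Sus.functor.obj Q)
  constructor
  · intro h
    have h1 := addClosure_of_map (homFrom T) (fun φ => ⟨_, (homFrom T).map_preimage φ⟩)
      (fun φ => ⟨_, (homFrom T).map_preimage φ⟩) (isIso_of_homFrom_map_eq_id hfin hT hY) h
    exact addClosure_trans (addClosure_biprod_iff.1 (addClosure_self _)).1 h1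
  · intro h
    refine addClosure_map (homFrom T) (addClosure_of_addClosure_biprod
      (hY.radPair k (addClosure_map Sus.functor hQ)).symm ?_)
    exact (addClosure_iff_of_iso_left (biprod.braiding _ _)).1 h

/-- Both sides of the self-perpendicularity condition are compatible with direct sums, so it may be
tested on reduced objects and on objects `Sus Q'`. These give the two clauses of maximality. -/
lemma Corresponds.isSelfPerpendicular_iff (hfin : ∀ X Y : C, Module.Finite k (X ⟶ Y))
    (hCY : IsCalabiYau k Sus) (hT : IsClusterTilting A T) {X : C}
    {p : (imageD T).FullSubcategory × (proj (Gam T)).FullSubcategory} (h : Corresponds Sus X p) :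
    IsSelfPerpendicular Sus X ↔ IsMaximalTauRigidPair k (d + 1) p := by
  obtain ⟨X', Q, ⟨e⟩, hX, hQ, ⟨a⟩, ⟨b⟩⟩ := h
  have hred : ∀ {Y : C} {N : ModuleCat.{v} (Gam T)}, IsReduced (Sus.functor.obj T) Y →
      ((homFrom T).obj Y ≅ N) → ((addClosure X Y ↔ ExtVanishes Sus X Y) ↔
        (addClosure p.1.obj N ↔ HomTauVanishes k (d + 1) p.1.obj N ∧
          HomTauVanishes k (d + 1) N p.1.obj ∧ HomVanishes p.2.obj N)) := by
    intro Y N hY eN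
    rw [addClosure_iff_of_iso_left e, extVanishes_iff_of_iso_left e, extVanishes_biprod_left_iff,
      ← addClosure_homFrom_iff_of_isReduced hfin hT hQ hY, homVanishes_iff hQ b eN,
      forall_hom_eq_zero_iff_extVanishes (Sus := Sus),
      extVanishes_iff_homTauVanishes hfin hCY hT hX hY a eN, addClosure_iff_of_iso_left a,
      addClosure_iff_of_iso_right eN, and_assoc]
  have hadd : ∀ {Q' : C} {N : ModuleCat.{v} (Gam T)}, addClosure T Q' →
      ((homFrom T).obj Q' ≅ N) → ((addClosure X (Sus.functor.obj Q') ↔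
        ExtVanishes Sus X (Sus.functor.obj Q')) ↔
        (addClosure p.2.obj N ↔ HomVanishes N p.1.obj)) := by
    intro Q' N hQ' eN
    have h1 := hT.1.extVanishes_map hQ hQ'
    rw [addClosure_iff_of_iso_left e, extVanishes_iff_of_iso_left e, extVanishes_biprod_left_iff,
      ← addClosure_homFrom_iff_of_addClosure hfin hX hQ hQ', homVanishes_iff hQ' eN a,
      forall_hom_eq_zero_iff_extVanishes (Sus := Sus), hCY.extVanishes_comm X',
      addClosure_iff_of_iso_left b, addClosure_iff_of_iso_right eN, and_iff_left h1]
  constructor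
  · refine fun h => ⟨fun N => ?_, fun N => ?_⟩
    · obtain ⟨Y, hY, ⟨eN⟩⟩ := exists_reduced_homFrom_iso hfin hT.1 N.property
      exact (hred hY eN).1 (h Y)
    · obtain ⟨Q', hQ', ⟨eN⟩⟩ := exists_addClosure_homFrom_iso N.property
      exact (hadd hQ' eN).1 (h _)
  · intro h Y
    obtain ⟨Y', Q', ⟨f⟩, hY, hQ'⟩ := exists_reduced_decomposition hfin Sus T Y
    have h1 := (hred hY (Iso.refl _)).2 (h.1 ⟨_, (homFrom T).obj_mem_essImage Y'⟩)
    have h2 := (hadd hQ' (Iso.refl _)).2 (h.2 ⟨_, proj_homFrom hQ'⟩)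
    rw [addClosure_iff_of_iso_right f, extVanishes_iff_of_iso_right f, addClosure_biprod_iff,
      hCY.extVanishes_biprod_right_iff, h1, h2]

/-! ### Smallness -/

lemma exists_presentation {R : Type v} [Ring R] (M : ModuleCat.{v} R) [Module.Finite R M] :
    ∃ p : Σ n : ℕ, Submodule R (Fin n → R),
      Nonempty (M ≅ ModuleCat.of R ((Fin p.1 → R) ⧸ p.2)) := by
  obtain ⟨n, π, hπ⟩ := Module.Finite.exists_fin' R M
  exact ⟨⟨n, LinearMap.ker π⟩, ⟨(π.quotKerEquivOfSurjective hπ).symm.toModuleIso⟩⟩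

/-- An object is determined up to isomorphism by two finitely generated `Γ`-modules, hence by two
pairs of a rank and a submodule of a free module; such data form a type in the universe of
morphisms. -/
lemma essentiallySmall_of_isClusterTilting (hfin : ∀ X Y : C, Module.Finite k (X ⟶ Y))
    (hT : IsClusterTilting A T) : EssentiallySmall.{v} C := by
  rw [essentiallySmall_iff]
  refine ⟨?_, inferInstance⟩
  have hex : ∀ X : C, ∃ q : (Σ n : ℕ, Submodule (Gam T) (Fin n → Gam T)) ×
      (Σ n : ℕ, Submodule (Gam T) (Fin n → Gam T)), ∃ X' Q : C,
      Nonempty (X ≅ X' ⊞ Sus.functor.obj Q) ∧ IsReduced (Sus.functor.obj T) X' ∧ addClosure T Q ∧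
      Nonempty ((homFrom T).obj X' ≅ ModuleCat.of (Gam T) ((Fin q.1.1 → Gam T) ⧸ q.1.2)) ∧
      Nonempty ((homFrom T).obj Q ≅ ModuleCat.of (Gam T) ((Fin q.2.1 → Gam T) ⧸ q.2.2)) := by
    intro X
    obtain ⟨X', Q, e, hX, hQ⟩ := exists_reduced_decomposition hfin Sus T X
    have := hfin T X'
    have := hfin T Q
    have := finite_homFrom (T := T) k X'
    have := finite_homFrom (T := T) k Q
    obtain ⟨q, hq⟩ := exists_presentation ((homFrom T).obj X')
    obtain ⟨q', hq'⟩ := exists_presentation ((homFrom T).obj Q)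
    exact ⟨(q, q'), X', Q, e, hX, hQ, hq, hq'⟩
  choose q hq using hex
  refine small_of_injective (f := fun s : Skeleton C => q ((fromSkeleton C).obj s))
    fun s t hst => ?_
  refine skeleton_skeletal C ?_
  obtain ⟨X', Q, ⟨e⟩, hX, hQ, ⟨a⟩, ⟨b⟩⟩ := hq ((fromSkeleton C).obj s)
  obtain ⟨Y', Q', ⟨e'⟩, hY, hQ', ⟨a'⟩, ⟨b'⟩⟩ := hq ((fromSkeleton C).obj t)
  have hst' : q ((fromSkeleton C).obj s) = q ((fromSkeleton C).obj t) := hst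
  rw [hst'] at a b
  obtain ⟨f⟩ := nonempty_iso_of_homFrom_iso hfin hT hX hY (a ≪≫ a'.symm)
  obtain ⟨g⟩ := nonempty_iso_of_homFrom_iso_of_addClosure hQ hQ' (b ≪≫ b'.symm)
  exact ⟨(fromSkeleton C).preimageIso
    (e ≪≫ biprod.mapIso f (Sus.functor.mapIso g) ≪≫ e'.symm)⟩

end Rigid

end

end HigherAngulated

/-! ### The bijection and its restrictions. -/

open HigherAngulated
theorem theorem3p6 {k : Type w} [Field k] [IsAlgClosed k]
    {C : Type u} [Category.{v} C] [Preadditive C] [Linear k C]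
    [HasFiniteBiproducts C] [HasBinaryBiproducts C] [IsIdempotentComplete C]
    (hfin : ∀ X Y : C, Module.Finite k (X ⟶ Y))
    (d : ℕ) (hd : 1 ≤ d)
    (Sus : C ≌ C) [Sus.functor.Additive] [Sus.functor.Linear k]
    (A : Angulation Sus d) (hCY : IsCalabiYau k Sus)
    (T : C) (hT : IsClusterTilting A T) :
    EssentiallySmall.{v} C ∧
    (∀ X : C, Nonempty (Decomposition Sus T X)) ∧
    ∃ δ : IsoClasses C →
        IsoClasses (imageD T).FullSubcategory × IsoClasses (proj (Gam T)).FullSubcategory,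
      (∀ (X : C) (c : Decomposition Sus T X), δ (isoClass X) = isoClassPair c.Δ) ∧
      Function.Bijective δ ∧
      Set.BijOn δ (isoClass '' {X : C | IsRigid Sus X})
        (isoClassPair '' {p | IsTauRigidPair k d p}) ∧
      Set.BijOn δ (isoClass '' {X : C | IsSelfPerpendicular Sus X})
        (isoClassPair '' {p | IsMaximalTauRigidPair k d p}) := by
  obtain ⟨d, rfl⟩ : ∃ e, d = e + 1 := ⟨d - 1, by omega⟩
  have : HasZeroObject C := hasZeroObject_of_hasFiniteBiproducts C
  have hdec : ∀ X : C, Nonempty (Decomposition Sus T X) := fun X => by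
    obtain ⟨X', X'', ⟨e⟩, h1, h2⟩ :=
      exists_biprod_isReduced k (fun X => hfin X X) (Sus.functor.obj T) X
    exact ⟨⟨X', X'', e, h1, h2⟩⟩
  refine ⟨essentiallySmall_of_isClusterTilting hfin hT, hdec, ?_⟩
  have hpair : ∀ {X Y : C} {p q : (imageD T).FullSubcategory × (proj (Gam T)).FullSubcategory},
      Nonempty (X ≅ Y) → Corresponds Sus X p → Corresponds Sus Y q →
      isoClassPair p = isoClassPair q := fun h hp hq => by
    obtain ⟨h1, h2⟩ := (hp.congr h ⟨Iso.refl _⟩ ⟨Iso.refl _⟩).nonempty_iso_pair hfin hq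
    exact Prod.ext (Quotient.sound h1) (Quotient.sound h2)
  let δ : IsoClasses C →
      IsoClasses (imageD T).FullSubcategory × IsoClasses (proj (Gam T)).FullSubcategory :=
    Quotient.lift (fun X => isoClassPair (hdec X).some.Δ) fun X Y h =>
      hpair h (hdec X).some.corresponds (hdec Y).some.corresponds
  have hδ : ∀ {X : C} {p : (imageD T).FullSubcategory × (proj (Gam T)).FullSubcategory},
      Corresponds Sus X p → δ (isoClass X) = isoClassPair p := fun hp =>
    hpair ⟨Iso.refl _⟩ (hdec _).some.corresponds hp
  have hδ' : ∀ {X : C} {p : (imageD T).FullSubcategory × (proj (Gam T)).FullSubcategory},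
      δ (isoClass X) = isoClassPair p → Corresponds Sus X p := fun {X p} h => by
    have h1 := congrArg Prod.fst h
    have h2 := congrArg Prod.snd h
    exact (hdec X).some.corresponds.congr ⟨Iso.refl _⟩ (Quotient.exact h1) (Quotient.exact h2)
  have hinj : Function.Injective δ := by
    intro x y
    induction x using Quotient.inductionOn with | _ X
    induction y using Quotient.inductionOn with | _ Y
    intro h
    exact Quotient.sound ((hδ' (h.trans (hδ (hdec Y).some.corresponds))).nonempty_iso hfin hT
      (hdec Y).some.corresponds)
  have hsurj : Function.Surjective δ := by
    rintro ⟨x, y⟩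
    induction x using Quotient.inductionOn with | _ M
    induction y using Quotient.inductionOn with | _ P
    obtain ⟨X, hX⟩ := exists_corresponds (Sus := Sus) hfin hT.1 (M, P)
    exact ⟨isoClass X, hδ hX⟩
  -- Only agreement along `Corresponds` is required; applied to all corresponding pairs, it also
  -- covers the isomorphism invariance of both properties.
  have hbij : ∀ (S : Set C)
      (S' : Set ((imageD T).FullSubcategory × (proj (Gam T)).FullSubcategory)),
      (∀ X p, Corresponds Sus X p → (X ∈ S ↔ p ∈ S')) →
      Set.BijOn δ (isoClass '' S) (isoClassPair '' S') := by
    intro S S' h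
    refine ⟨?_, hinj.injOn, ?_⟩
    · rintro _ ⟨X, hX, rfl⟩
      exact ⟨_, (h _ _ (hdec X).some.corresponds).1 hX, rfl⟩
    · rintro _ ⟨p, hp, rfl⟩
      obtain ⟨X, hX⟩ := exists_corresponds (Sus := Sus) hfin hT.1 p
      exact ⟨_, ⟨X, (h _ _ hX).2 hp, rfl⟩, hδ hX⟩
  exact ⟨δ, fun X c => hδ c.corresponds, ⟨hinj, hsurj⟩,
    hbij _ _ fun _ _ h => h.isRigid_iff hfin hCY hT,
    hbij _ _ fun _ _ h => h.isSelfPerpendicular_iff hfin hCY hT⟩
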